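/- Let $p$ be a prime, $q=p^t$ with $t\ge 1$, and let $n$ and $r>2$ be distinct primes. Consider the finite fields $\mathbb F_q\subset\mathbb F_{q^n}\subset\mathbb F_{q^{nr}}$. Let $\mathbb S$ be the set of elements of $\mathbb F_{q^{nr}}$ of degree $r$ over $\mathbb F_{q^n}$. For $\alpha\in\mathbb S$ let $$O(\alpha)=\left\{\frac{a\alpha+b}{c\alpha+d} : a,b,c,d\in\mathbb F_{q^n},\ ad-bc\neq 0\right\}$$ be its orbit under $PGL(2,q^n)$ (a projective linear set), and let $\mathbb O=\{O(\alpha):\alpha\in\mathbb S\}$. Let $G=\{\sigma^i\}$ be the group generated by the Frobenius automorphism $\sigma:\alpha\mapsto\alpha^q$ of $\mathbb F_{q^{nr}}$, acting on $\mathbb O$ by $\sigma^i(O(\alpha))=O(\sigma^i(\alpha))$. Then the number of orbits of $G$ on $\mathbb O$ is 1. $\displaystyle\frac1{nr}\left[\frac{q^{n(r-1)}-1}{q^{2n}-1}+n(r-1)+\frac{(n-1)(q^{r-1}-1)}{q^2-1}\right]$ if $r=p$; 2. $\displaystyle\frac1{nr}\left[\frac{q^{n(r-1)}-1}{q^{2n}-1}+\frac{n(r-1)^2}{2}+\frac{(n-1)(q^{r-1}-1)}{q^2-1}\right]$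 if $r\ne p$ and $r\mid q-1$; or $r\neq p$, $r\mid q^n-1$, $r\nmid q-1$ and $r\mid q+1$; or $r\ne p$, $r\nmid q^n-1$, $r\mid q^n+1$ and $r\mid q+1$; 3. $\displaystyle\frac1{nr}\left[\frac{q^{n(r-1)}-1}{q^{2n}-1}+\frac{(r-1)^2}{2}+\frac{(n-1)(q^{r-1}-1)}{q^2-1}\right]$ if $r\ne p$, $r\nmid q^n-1$, $r\mid q^n+1$ and $r\nmid q+1$; or $r\ne p$, $r\mid q^n-1$, $r\nmid q-1$ and $r\nmid q+1$; 4. $\displaystyle\frac1{nr}\left[\frac{q^{n(r-1)}-1}{q^{2n}-1}+\frac{(n-1)(q^{r-1}-1)}{q^2-1}\right]$ if $r\ne p$, $r\nmid q^n-1$ and $r\nmid q^n+1$. Moreover, this number of orbits is an upper bound for the number of extended irreducible $q$-ary Goppa codes of degree $r$ and length $q^n+1$, counted up to equivalence (permutation of coordinates). Here, for an enumeration $\zeta_0,\dots,\zeta_{q^n-1}$ of $\mathbb F_{q^n}$ and an irreducible $g\in\mathbb F_{q^n}[z]$ of degree $r$, the Goppa code $\Gamma(L,g)$ consists of all $(c_0,\dots,c_{q^n-1})\in\mathbb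 F_q^{q^n}$ with $\sum_i c_i/(z-\zeta_i)\equiv 0 \bmod g(z)$, and the extended code consists of all $(c_0,\dots,c_{q^n})\in\mathbb F_q^{q^n+1}$ with $(c_0,\dots,c_{q^n-1})\in\Gamma(L,g)$ and $\sum_{i=0}^{q^n}c_i=0$. -/

import Mathlib

open scoped Pointwise Polynomial

namespace GoppaCount

section ProjectiveLinearSets

/-- `𝕊`: the elements of `E` of degree `r` over `K`. -/
def degreeSet (K E : Type*) [Field K] [Field E] [Algebra K E] (r : ℕ) : Set E :=
  {α | (minpoly K α).natDegree = r}

/-- The projective linear set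
`O(α) = { (a α + b) / (c α + d) : a, b, c, d ∈ K, a d - b c ≠ 0 }`,
that is, the orbit of `α` under the fractional linear transformations `PGL(2, K)`. It is only
used for `α` of degree greater than two over `K`, so that no denominator vanishes. -/
def projLinSet (K : Type*) {E : Type*} [Field K] [Field E] [Algebra K E] (α : E) : Set E :=
  {β | ∃ a b c d : K, a * d - b * c ≠ 0 ∧
    β = (algebraMap K E a * α + algebraMap K E b) / (algebraMap K E c * α + algebraMap K E d)}

/-- The group `G` of all powers of the Frobenius automorphism `σ : α ↦ α ^ |F|` of `E`. -/
noncomputable def frobGroup (F E : Type*) [Field F] [Fintype F] [Field E] [Finite E]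
    [Algebra F E] : Subgroup (E ≃ₐ[F] E) :=
  Subgroup.zpowers (FiniteField.frobeniusAlgEquivOfAlgebraic F E)

variable {F K E : Type*} [Field F] [Field K] [Finite K] [Field E]
  [Algebra F K] [Algebra K E] [Algebra F E] [IsScalarTower F K E]

theorem natDegree_minpoly_apply_le [Finite E] (σ : E ≃ₐ[F] E) (α : E) :
    (minpoly K (σ α)).natDegree ≤ (minpoly K α).natDegree := by
  have hcomp : ((algebraMap K E).comp ((σ.restrictNormal K : K ≃ₐ[F] K) : K →+* K)) =
      (σ : E →+* E).comp (algebraMap K E) := by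
    ext x
    exact σ.restrictNormal_commutes K x
  have hint : IsIntegral K α := Algebra.IsIntegral.isIntegral α
  have hroot : Polynomial.aeval (σ α)
      ((minpoly K α).map ((σ.restrictNormal K : K ≃ₐ[F] K) : K →+* K)) = 0 := by
    rw [Polynomial.aeval_def, Polynomial.eval₂_map, hcomp]
    have h := Polynomial.hom_eval₂ (minpoly K α) (algebraMap K E) (σ : E →+* E) α
    have h0 : Polynomial.eval₂ (algebraMap K E) α (minpoly K α) = 0 := minpoly.aeval K α
    rw [h0, map_zero] at h
    exact h.symm
  have hmonic := (minpoly.monic hint).map ((σ.restrictNormal K : K ≃ₐ[F] K) : K →+* K)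
  refine (Polynomial.natDegree_le_of_dvd (minpoly.dvd K _ hroot) hmonic.ne_zero).trans ?_
  exact Polynomial.natDegree_map_le

theorem apply_mem_degreeSet [Finite E] (σ : E ≃ₐ[F] E) {r : ℕ} {α : E}
    (hα : α ∈ degreeSet K E r) : σ α ∈ degreeSet K E r := by
  have h1 := natDegree_minpoly_apply_le (K := K) σ α
  have h2 := natDegree_minpoly_apply_le (K := K) σ.symm (σ α)
  rw [AlgEquiv.symm_apply_apply] at h2
  exact (le_antisymm h1 h2).trans hα

theorem image_projLinSet_subset (σ : E ≃ₐ[F] E) (α : E) :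
    σ '' projLinSet K α ⊆ projLinSet K (σ α) := by
  rintro _ ⟨_, ⟨a, b, c, d, hdet, rfl⟩, rfl⟩
  have hc := σ.restrictNormal_commutes K
  refine ⟨σ.restrictNormal K a, σ.restrictNormal K b, σ.restrictNormal K c,
    σ.restrictNormal K d, ?_, ?_⟩
  · rw [← map_mul, ← map_mul, ← map_sub]
    exact (map_ne_zero _).mpr hdet
  · simp only [hc, map_div₀, map_add, map_mul]

theorem image_projLinSet (σ : E ≃ₐ[F] E) (α : E) :
    σ '' projLinSet K α = projLinSet K (σ α) := by
  refine (image_projLinSet_subset σ α).antisymm fun β hβ => ?_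
  have h := image_projLinSet_subset (K := K) σ.symm (σ α) ⟨β, hβ, rfl⟩
  rw [AlgEquiv.symm_apply_apply] at h
  exact ⟨_, h, σ.apply_symm_apply β⟩

/-- `𝕆 = {O(α) : α ∈ 𝕊}`, as a set of subsets of `E` with the action of `G` by
`σ • X = {σ(x) : x ∈ X}`. -/
noncomputable def projLinSets (F K E : Type*) [Field F] [Fintype F] [Field K] [Finite K]
    [Field E] [Finite E] [Algebra F K] [Algebra K E] [Algebra F E] [IsScalarTower F K E]
    (r : ℕ) : SubMulAction (frobGroup F E) (Set E) where
  carrier := {X | ∃ α ∈ degreeSet K E r, X = projLinSet K α}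
  smul_mem' := by
    rintro σ _ ⟨α, hα, rfl⟩
    exact ⟨(σ : E ≃ₐ[F] E) α, apply_mem_degreeSet _ hα, image_projLinSet (K := K) (σ : E ≃ₐ[F] E) α⟩

/-- The number of orbits of `G` on `𝕆`. -/
noncomputable def numOrbits (F K E : Type*) [Field F] [Fintype F] [Field K] [Finite K]
    [Field E] [Finite E] [Algebra F K] [Algebra K E] [Algebra F E] [IsScalarTower F K E]
    (r : ℕ) : ℕ :=
  Nat.card (MulAction.orbitRel.Quotient (frobGroup F E) (projLinSets F K E r))

end ProjectiveLinearSets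

section Codes

variable {F K : Type*} [Field F] [Field K] [Algebra F K] {N : ℕ}

/-- The Goppa code `Γ(L, g)`, where `L = K = {ζ 0, …, ζ (N - 1)}`: all vectors `c` over `F` with
`∑ i, c i / (z - ζ i) ≡ 0 mod g(z)`, the inverses being taken in `K[z] / (g)`. They exist when
`g` has no root in `K`, in particular when `g` is irreducible of degree at least two. -/
noncomputable def goppaCode (ζ : Fin N ≃ K) (g : K[X]) : Submodule F (Fin N → F) where
  carrier := {c | ∑ i, AdjoinRoot.of g (algebraMap F K (c i)) *
    Ring.inverse (AdjoinRoot.mk g (Polynomial.X - Polynomial.C (ζ i))) = 0}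
  zero_mem' := by simp
  add_mem' := by
    intro c d hc hd
    simp only [Set.mem_ofPred_eq] at hc hd ⊢
    simp only [Pi.add_apply, map_add, add_mul, Finset.sum_add_distrib, hc, hd, add_zero]
  smul_mem' := by
    intro a c hc
    simp only [Set.mem_ofPred_eq] at hc ⊢
    simp only [Pi.smul_apply, smul_eq_mul, map_mul, mul_assoc, ← Finset.mul_sum, hc, mul_zero]

/-- The extension of a code of length `N` by an overall parity check. -/
def extendedCode (C : Submodule F (Fin N → F)) : Submodule F (Fin (N + 1) → F) where
  carrier := {c | (fun i : Fin N => c i.castSucc) ∈ C ∧ ∑ i, c i = 0}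
  zero_mem' := ⟨C.zero_mem, by simp⟩
  add_mem' := by
    rintro c d ⟨hc, hc'⟩ ⟨hd, hd'⟩
    refine ⟨C.add_mem hc hd, ?_⟩
    simp only [Pi.add_apply, Finset.sum_add_distrib, hc', hd', add_zero]
  smul_mem' := by
    rintro a c ⟨hc, hc'⟩
    refine ⟨C.smul_mem a hc, ?_⟩
    simp only [Pi.smul_apply, ← Finset.smul_sum, hc', smul_zero]

/-- The set of all extended irreducible Goppa codes of degree `r` (and length `N + 1`, where
`N = |K|`) over `F`. -/
def extendedGoppaCodes (F : Type*) {K : Type*} [Field F] [Field K] [Algebra F K] {N : ℕ}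
    (ζ : Fin N ≃ K) (r : ℕ) : Set (Submodule F (Fin (N + 1) → F)) :=
  {C | ∃ g : K[X], Irreducible g ∧ g.natDegree = r ∧ C = extendedCode (goppaCode ζ g)}

/-- Two codes are equivalent if a permutation of the coordinates carries one to the other. -/
def CodeEquiv {M : ℕ} (C D : Submodule F (Fin M → F)) : Prop :=
  ∃ π : Equiv.Perm (Fin M), ∀ c : Fin M → F, c ∈ C ↔ (fun i => c (π i)) ∈ D

/-- Equivalence of codes as an equivalence relation on the extended irreducible Goppa codes. -/
def codeSetoid (F : Type*) {K : Type*} [Field F] [Field K] [Algebra F K] {N : ℕ}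
    (ζ : Fin N ≃ K) (r : ℕ) : Setoid (extendedGoppaCodes F ζ r) where
  r C D := CodeEquiv C.1 D.1
  iseqv :=
    { refl := fun _ => ⟨1, fun _ => Iff.rfl⟩
      symm := by
        rintro C D ⟨π, h⟩
        refine ⟨π.symm, fun c => ?_⟩
        have h' := h (fun i => c (π.symm i))
        simp only [Equiv.symm_apply_apply] at h'
        exact h'.symm
      trans := by
        rintro C D B ⟨π, h⟩ ⟨ρ, h'⟩
        exact ⟨π * ρ, fun c => (h c).trans (h' _)⟩ }

/-- The number of inequivalent extended irreducible Goppa codes of degree `r`. -/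
noncomputable def numExtendedGoppaCodes (F : Type*) {K : Type*} [Field F] [Field K]
    [Algebra F K] {N : ℕ} (ζ : Fin N ≃ K) (r : ℕ) : ℕ :=
  Nat.card (Quotient (codeSetoid F ζ r))

end Codes

end GoppaCount

/-!
# Orbits of the Frobenius group on projective linear sets

Write `Q = q ^ n`. Burnside's lemma for the cyclic group `G` of order `n r` reduces the count to the
numbers `N`, `b`, `a`, `c` of projective linear sets invariant under Frobenius automorphisms of
order `1`, `n`, `r`, `n r`: the number of orbits times `n r` is
`N + (n - 1) b + (r - 1) a + (n - 1) (r - 1) c` (`exists_orbit_count`). The generator is written as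
a product `τ ρ` of commuting automorphisms of orders `n` and `r`; `ρ` has fixed field `K`, and `τ`
restricts to the Frobenius of `K / F`.

* The elements of `O(α)` have unique normal forms `u α + b` and `u / (α + d) + b`, because `α`
  satisfies no quadratic equation over `K`. So `|O(α)| = Q ^ 3 - Q`, which gives
  `N = (Q ^ (r - 1) - 1) / (Q ^ 2 - 1)`. If `α` is fixed by `τ`, the points of `O(α)` fixed by `τ`
  are those whose parameters lie in `F`. Every `τ`-invariant `O(α)` has such a point
  (`exists_fixed_mem_projLinSet`): if `τ α = (a α + b) / (c α + d)`, then `x ↦ (c α + d) τ(x)`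
  preserves the `K`-plane spanned by `1` and `α`; by surjectivity of the norm it can be rescaled to
  have order dividing `n`, then by independence of characters its fixed vectors span the plane,
  and the quotient of two independent ones is the point sought. Hence
  `b = (q ^ (r - 1) - 1) / (q ^ 2 - 1)`; both counts are `card_invariantSets`.
* A `ρ`-invariant set contains a point with `ρ x = -d / (x + 1)` for some `d` in `K`, and `d`
  determines the set. As `ρ ^ r = 1`, `d` is a root of a nonzero polynomial of degree at most
  `(r - 1) / 2`. So `c ≤ a ≤ (r - 1) / 2` (`card_invariantSets_le`).
* Since `ρ` has prime order `r`, counting its fixed points gives `a ≡ N` and `c ≡ b` modulo `r`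
  (`card_invariantSets_modEq`). Together with the upper bound this determines `a` and `c`: they are
  `1`, `(r - 1) / 2` or `0` according as `r` divides `Q`, `Q ^ 2 - 1` or neither, respectively `q`,
  `q ^ 2 - 1` or neither (`eq_of_modEq_of_card`). No invariant sets need to be exhibited.

For the codes, let `α` be a root of the Goppa polynomial. A word `c` on the projective line over `K`
lies in the extended code if and only if `∑ c_P / (α - P) = 0` and `∑ c_P = 0`. A fractional linear
transformation applied to both `α` and `P` changes `1 / (α - P)` by an affine function whose
coefficients do not depend on `P`, and Frobenius permutes the points; so roots whose projective
linear sets lie in one orbit give equivalent codes (`numExtendedGoppaCodes_le`).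
-/

namespace GoppaCount

/-! ### Fractional linear transformations -/

section Moebius

variable {K E : Type*} [Field K] [Field E] [Algebra K E]

/-- An element of degree greater than two satisfies no quadratic relation. -/
theorem quadratic_eq_zero {α : E} (hα : 2 < (minpoly K α).natDegree) {a b c : K}
    (h : algebraMap K E a * α ^ 2 + algebraMap K E b * α + algebraMap K E c = 0) :
    a = 0 ∧ b = 0 ∧ c = 0 := by
  set p : K[X] := Polynomial.C a * Polynomial.X ^ 2 + Polynomial.C b * Polynomial.X
    + Polynomial.C c with hp
  have hroot : Polynomial.aeval α p = 0 := by simpa [hp] using h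
  have hp0 : p = 0 := by
    by_contra hne
    have h1 := Polynomial.natDegree_le_natDegree (minpoly.degree_le_of_ne_zero K α hne hroot)
    have h2 : p.natDegree ≤ 2 := Polynomial.natDegree_quadratic_le
    omega
  refine ⟨?_, ?_, ?_⟩
  · simpa [hp, Polynomial.coeff_X, Polynomial.coeff_C] using congrArg (fun f => f.coeff 2) hp0
  · simpa [hp, Polynomial.coeff_X, Polynomial.coeff_C] using congrArg (fun f => f.coeff 1) hp0
  · simpa [hp, Polynomial.coeff_X, Polynomial.coeff_C] using congrArg (fun f => f.coeff 0) hp0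

variable (K E) in
/-- Every element of `E` outside `K` has degree greater than two over `K`. -/
def NoQuadratic : Prop :=
  ∀ α : E, α ∉ Set.range (algebraMap K E) → 2 < (minpoly K α).natDegree

theorem natDegree_minpoly_eq_finrank {r : ℕ} (hr : r.Prime) (hfin : Module.finrank K E = r)
    {α : E} (hα : α ∉ Set.range (algebraMap K E)) : (minpoly K α).natDegree = r := by
  have : FiniteDimensional K E := Module.finite_of_finrank_pos (hfin ▸ hr.pos)
  have hdvd := minpoly.degree_dvd (K := K) (Algebra.IsIntegral.isIntegral (R := K) α)
  rw [hfin] at hdvd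
  rcases (Nat.dvd_prime hr).1 hdvd with h | h
  · exact absurd (minpoly.natDegree_eq_one_iff.1 h) hα
  · exact h

theorem noQuadratic_of_finrank {r : ℕ} (hr : r.Prime) (hr2 : 2 < r)
    (hfin : Module.finrank K E = r) : NoQuadratic K E := fun _ hα =>
  (natDegree_minpoly_eq_finrank hr hfin hα).symm ▸ hr2

theorem mem_degreeSet_iff {r : ℕ} (hr : r.Prime) (hfin : Module.finrank K E = r) {α : E} :
    α ∈ degreeSet K E r ↔ α ∉ Set.range (algebraMap K E) := by
  refine ⟨?_, natDegree_minpoly_eq_finrank hr hfin⟩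
  rintro hα ⟨x, rfl⟩
  have h : (minpoly K (algebraMap K E x)).natDegree = 1 := minpoly.natDegree_eq_one_iff.2 ⟨x, rfl⟩
  exact hr.one_lt.ne' (hα.symm.trans h)

theorem linear_eq_zero {α : E} (hα : α ∉ Set.range (algebraMap K E)) {c d : K}
    (h : algebraMap K E c * α + algebraMap K E d = 0) : c = 0 ∧ d = 0 := by
  have hc : c = 0 := by
    by_contra hc
    have hc' : algebraMap K E c ≠ 0 := (map_ne_zero _).2 hc
    refine hα ⟨-d / c, ?_⟩
    rw [map_div₀, map_neg, div_eq_iff hc']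
    linear_combination -h
  subst hc
  simpa using h

theorem denom_ne_zero {α : E} (hα : α ∉ Set.range (algebraMap K E)) {a b c d : K}
    (hdet : a * d - b * c ≠ 0) : algebraMap K E c * α + algebraMap K E d ≠ 0 := by
  intro h
  obtain ⟨rfl, rfl⟩ := linear_eq_zero hα h
  simp at hdet

theorem mem_projLinSet_iff {α β : E} (hα : α ∉ Set.range (algebraMap K E)) :
    β ∈ projLinSet K α ↔ ∃ a b c d : K, a * d - b * c ≠ 0 ∧
      β * (algebraMap K E c * α + algebraMap K E d) = algebraMap K E a * α + algebraMap K E b := by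
  constructor
  · rintro ⟨a, b, c, d, hdet, rfl⟩
    exact ⟨a, b, c, d, hdet, div_mul_cancel₀ _ (denom_ne_zero hα hdet)⟩
  · rintro ⟨a, b, c, d, hdet, h⟩
    exact ⟨a, b, c, d, hdet, (eq_div_iff (denom_ne_zero hα hdet)).2 h⟩

theorem self_mem_projLinSet (α : E) : α ∈ projLinSet K α :=
  ⟨1, 0, 0, 1, by simp, by simp⟩

theorem notMem_range_of_mem_projLinSet {α β : E} (hα : α ∉ Set.range (algebraMap K E))
    (hβ : β ∈ projLinSet K α) : β ∉ Set.range (algebraMap K E) := by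
  rintro ⟨x, rfl⟩
  obtain ⟨a, b, c, d, hdet, h⟩ := (mem_projLinSet_iff hα).1 hβ
  obtain ⟨h1, h2⟩ := linear_eq_zero (c := x * c - a) (d := x * d - b) hα
    (by simp only [map_sub, map_mul]; linear_combination h)
  apply hdet
  linear_combination d * (-h1) + c * h2

theorem mem_projLinSet_symm {α β : E} (hα : α ∉ Set.range (algebraMap K E))
    (hβ : β ∈ projLinSet K α) : α ∈ projLinSet K β := by
  obtain ⟨a, b, c, d, hdet, h⟩ := (mem_projLinSet_iff hα).1 hβ
  rw [mem_projLinSet_iff (notMem_range_of_mem_projLinSet hα hβ)]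
  refine ⟨d, -b, -c, a, by convert hdet using 1; ring, ?_⟩
  simp only [map_neg]
  linear_combination -h

theorem mem_projLinSet_trans {α β γ : E} (hα : α ∉ Set.range (algebraMap K E))
    (hβ : β ∈ projLinSet K α) (hγ : γ ∈ projLinSet K β) : γ ∈ projLinSet K α := by
  have hβ' := notMem_range_of_mem_projLinSet hα hβ
  obtain ⟨a, b, c, d, hdet, h⟩ := (mem_projLinSet_iff hα).1 hβ
  obtain ⟨a', b', c', d', hdet', h'⟩ := (mem_projLinSet_iff hβ').1 hγ
  refine (mem_projLinSet_iff hα).2 ⟨a' * a + b' * c, a' * b + b' * d, c' * a + d' * c,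
    c' * b + d' * d, ?_, ?_⟩
  · convert mul_ne_zero hdet hdet' using 1
    ring
  · simp only [map_mul, map_add]
    linear_combination (algebraMap K E c * α + algebraMap K E d) * h'
      + (algebraMap K E a' - γ * algebraMap K E c') * h

theorem projLinSet_eq_iff {α β : E} (hα : α ∉ Set.range (algebraMap K E)) :
    projLinSet K β = projLinSet K α ↔ β ∈ projLinSet K α := by
  refine ⟨fun h => h ▸ self_mem_projLinSet β, fun h => Set.Subset.antisymm
    (fun γ hγ => mem_projLinSet_trans hα h hγ) fun γ hγ => ?_⟩
  exact mem_projLinSet_trans (notMem_range_of_mem_projLinSet hα h) (mem_projLinSet_symm hα h) hγ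

/-- Normal forms for the elements of `projLinSet K α`: the element `u α + b` for the first
coordinate `none`, and `u / (α + d) + b` for the first coordinate `some d`. -/
def moebiusParam (α : E) : Option K × Kˣ × K → E
  | (none, u, b) => algebraMap K E u * α + algebraMap K E b
  | (some d, u, b) => algebraMap K E u / (α + algebraMap K E d) + algebraMap K E b

theorem add_algebraMap_ne_zero {α : E} (hα : α ∉ Set.range (algebraMap K E)) (d : K) :
    α + algebraMap K E d ≠ 0 := by
  intro h
  have := linear_eq_zero (c := 1) (d := d) hα (by simpa using h)
  exact one_ne_zero this.1

theorem range_moebiusParam {α : E} (hα : α ∉ Set.range (algebraMap K E)) :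
    Set.range (moebiusParam (K := K) α) = projLinSet K α := by
  ext β
  constructor
  · rintro ⟨⟨_ | d, u, b⟩, rfl⟩
    · exact (mem_projLinSet_iff hα).2 ⟨u, b, 0, 1, by simp, by simp [moebiusParam]⟩
    · refine (mem_projLinSet_iff hα).2 ⟨b, u + b * d, 1, d, by
        rw [show b * d - (u + b * d) * 1 = -(u : K) by ring]; simp, ?_⟩
      have := add_algebraMap_ne_zero hα d
      simp only [moebiusParam, map_add, map_mul, map_one, one_mul]
      field_simp
      ring
  · intro hβ
    obtain ⟨a, b, c, d, hdet, h⟩ := (mem_projLinSet_iff hα).1 hβ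
    by_cases hc : c = 0
    · subst hc
      have hd : d ≠ 0 := by rintro rfl; simp at hdet
      have ha : a ≠ 0 := by rintro rfl; simp at hdet
      have hd' : algebraMap K E d ≠ 0 := (map_ne_zero _).2 hd
      refine ⟨(none, Units.mk0 (a / d) (div_ne_zero ha hd), b / d), ?_⟩
      simp only [moebiusParam, Units.val_mk0, map_div₀]
      field_simp
      simp only [map_zero, zero_mul, zero_add] at h
      rw [h.symm, mul_comm]
    · have hc' : algebraMap K E c ≠ 0 := (map_ne_zero _).2 hc
      have hu : (b * c - a * d) / c ^ 2 ≠ 0 :=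
        div_ne_zero (fun h => hdet (by linear_combination -h)) (pow_ne_zero 2 hc)
      refine ⟨(some (d / c), Units.mk0 _ hu, a / c), ?_⟩
      have h0 := denom_ne_zero hα hdet
      have h1 := add_algebraMap_ne_zero hα (d / c)
      rw [← eq_div_iff h0] at h
      rw [h]
      have h2 : α + algebraMap K E (d / c) =
          (algebraMap K E c * α + algebraMap K E d) / algebraMap K E c := by
        rw [map_div₀]; field_simp
      simp only [moebiusParam, Units.val_mk0]
      rw [h2]
      simp only [map_div₀, map_sub, map_mul, map_pow]
      field_simp
      ring

theorem moebiusParam_injective (hKE : NoQuadratic K E) {α : E}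
    (hα : α ∉ Set.range (algebraMap K E)) : Function.Injective (moebiusParam (K := K) α) := by
  have h2 := hKE α hα
  rintro ⟨_ | d, u, b⟩ ⟨_ | d', u', b'⟩ h
  · obtain ⟨h3, h4⟩ := linear_eq_zero (c := u - u') (d := b - b') hα (by
      simp only [moebiusParam] at h
      simp only [map_sub]; linear_combination h)
    simp [Units.ext_iff, sub_eq_zero.1 h3, sub_eq_zero.1 h4]
  · have h1 := add_algebraMap_ne_zero hα d'
    simp only [moebiusParam] at h
    field_simp at h
    have := quadratic_eq_zero (a := u) (b := u * d' + b - b') (c := b * d' - u' - b' * d') h2 (by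
      simp only [map_sub, map_add, map_mul]; linear_combination h)
    exact absurd this.1 u.ne_zero
  · have h1 := add_algebraMap_ne_zero hα d
    simp only [moebiusParam] at h
    field_simp at h
    have := quadratic_eq_zero (a := u') (b := u' * d + b' - b) (c := b' * d - u - b * d) h2 (by
      simp only [map_sub, map_add, map_mul]; linear_combination -h)
    exact absurd this.1 u'.ne_zero
  · have h1 := add_algebraMap_ne_zero hα d
    have h1' := add_algebraMap_ne_zero hα d'
    simp only [moebiusParam] at h
    field_simp at h
    obtain ⟨h3, h4, h5⟩ := quadratic_eq_zero (a := b - b')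
      (b := u - u' + (b - b') * (d + d')) (c := u * d' - u' * d + (b - b') * d * d') h2 (by
      simp only [map_sub, map_add, map_mul]; linear_combination h)
    have hb : b = b' := sub_eq_zero.1 h3
    subst hb
    have hu : (u : K) = u' := by linear_combination h4
    rw [hu] at h5
    have hd : d = d' := by
      have : (u' : K) * (d' - d) = 0 := by linear_combination h5
      rcases mul_eq_zero.1 this with h | h
      · exact absurd h u'.ne_zero
      · exact (sub_eq_zero.1 h).symm
    simp [Units.ext_iff, hu, hd]

end Moebius

/-! ### Descent of invariant projective linear sets -/

section Descent

/-- Artin's independence of characters for the powers of Frobenius: a family of coefficients whose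
associated `q`-polynomial vanishes identically is zero. -/
theorem eq_zero_of_sum_mul_pow_card_eq_zero {F K : Type*} [Field F] [Field K] [Finite K]
    [Algebra F K] (c : ℕ → K)
    (h : ∀ x : K, ∑ i ∈ Finset.range (Module.finrank F K), c i * x ^ (Nat.card F ^ i) = 0)
    {i : ℕ} (hi : i < Module.finrank F K) : c i = 0 := by
  have : Finite F := Finite.of_injective _ (algebraMap F K).injective
  have : Fintype F := Fintype.ofFinite F
  let χ : Fin (Module.finrank F K) → (K →* K) := fun i =>
    ((FiniteField.frobeniusAlgHom F K ^ i.1 : K →ₐ[F] K) : K →* K)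
  have hχ : Function.Injective χ := by
    intro i j hij
    apply (FiniteField.bijective_frobeniusAlgHom_pow F K).injective
    ext x
    exact DFunLike.congr_fun hij x
  have hlin := (linearIndependent_monoidHom K K).comp χ hχ
  rw [Fintype.linearIndependent_iff] at hlin
  refine hlin (fun i => c i) ?_ ⟨i, hi⟩
  ext x
  rw [Finset.sum_apply]
  have hx := h x
  rw [Finset.sum_range] at hx
  simpa [χ, AlgHom.coe_pow, FiniteField.coe_frobeniusAlgHom, pow_iterate,
    Nat.card_eq_fintype_card] using hx

theorem mem_range_algebraMap_iff_pow_card_eq {F K : Type*} [Field F] [Finite F] [Field K]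
    [Algebra F K] {s : K} : s ∈ Set.range (algebraMap F K) ↔ s ^ Nat.card F = s := by
  classical
  have : Fintype F := Fintype.ofFinite F
  constructor
  · rintro ⟨z, rfl⟩
    rw [← map_pow, Nat.card_eq_fintype_card, FiniteField.pow_card]
  intro hsF
  by_contra hcon
  -- the image of `F` already exhausts the roots of `X ^ |F| - X`
  have hp : (Polynomial.X ^ Nat.card F - Polynomial.X : K[X]) ≠ 0 :=
    FiniteField.X_pow_card_sub_X_ne_zero K Finite.one_lt_card
  let S : Finset K := insert s (Finset.univ.map ⟨_, (algebraMap F K).injective⟩)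
  have hle := Polynomial.card_le_degree_of_subset_roots (Z := S)
    (p := (Polynomial.X ^ Nat.card F - Polynomial.X : K[X])) (by
      intro y hy
      rw [Polynomial.mem_roots hp, Polynomial.IsRoot]
      simp only [Polynomial.eval_sub, Polynomial.eval_pow, Polynomial.eval_X, sub_eq_zero]
      rcases Finset.mem_insert.1 hy with rfl | hy
      · exact hsF
      · obtain ⟨z, -, rfl⟩ := Finset.mem_map.1 hy
        simp [← map_pow, Nat.card_eq_fintype_card, FiniteField.pow_card])
  rw [FiniteField.X_pow_card_sub_X_natDegree_eq K Finite.one_lt_card,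
    Finset.card_insert_of_notMem, Finset.card_map, Finset.card_univ,
    Nat.card_eq_fintype_card] at hle
  · omega
  · intro hmem
    obtain ⟨z, -, hz⟩ := Finset.mem_map.1 hmem
    exact hcon ⟨z, hz⟩

variable {F K E : Type*} [Field F] [Field K] [Finite K] [Field E]
  [Algebra F K] [Algebra K E] [Algebra F E]

theorem iterate_mul_apply (τ : E ≃ₐ[F] E) (μ : E) (i : ℕ) (x : E) :
    (fun x => μ * τ x)^[i] x = (∏ j ∈ Finset.range i, (τ ^ j) μ) * (τ ^ i) x := by
  induction i generalizing x with
  | zero => simp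
  | succ i ih =>
    rw [Function.iterate_succ_apply, ih, map_mul, Finset.prod_range_succ, pow_succ τ i,
      AlgEquiv.mul_apply, mul_assoc]

/-- A semilinear map `x ↦ μ τ(x)` of order dividing `n = [K : F]` that preserves a `K`-subspace
has a fixed vector of that subspace outside any given line not containing the subspace. The fixed
vector is a trace `∑ Tⁱ(x w)` for a suitable scalar `x`. -/
theorem exists_fixed_notMem_span (τ : E ≃ₐ[F] E)
    (hτK : ∀ k : K, τ (algebraMap K E k) = algebraMap K E (k ^ Nat.card F)) (μ : E)
    (hT : ∀ x, (fun x => μ * τ x)^[Module.finrank F K] x = x) (W : Submodule K E)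
    (hW : ∀ w ∈ W, μ * τ w ∈ W) (v w : E) (hw : w ∈ W) (hv : w ∉ Submodule.span K {v}) :
    ∃ w' ∈ W, μ * τ w' = w' ∧ w' ∉ Submodule.span K {v} := by
  set T : E → E := fun x => μ * τ x with hTdef
  obtain ⟨f, hfw, hf⟩ := Submodule.exists_dual_map_eq_bot_of_notMem hv inferInstance
  have hfv : ∀ u ∈ Submodule.span K {v}, f u = 0 := fun u hu => by
    have : f u ∈ (Submodule.span K {v}).map f := ⟨u, hu, rfl⟩
    rwa [hf, Submodule.mem_bot] at this
  have hsemi : ∀ (i : ℕ) (x : K) (u : E),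
      T^[i] (x • u) = (x ^ (Nat.card F ^ i)) • T^[i] u := by
    intro i
    induction i with
    | zero => simp
    | succ i ih =>
      intro x u
      have h1 : T (x • u) = x ^ Nat.card F • T u := by
        simp only [hTdef, Algebra.smul_def, map_mul, hτK]
        ring
      rw [Function.iterate_succ_apply, h1, ih, ← pow_mul, ← pow_succ', Function.iterate_succ_apply]
  have hTW : ∀ i, T^[i] w ∈ W := by
    intro i
    induction i with
    | zero => exact hw
    | succ i ih => rw [Function.iterate_succ_apply']; exact hW _ ih
  obtain ⟨x, hx⟩ : ∃ x : K,
      ∑ i ∈ Finset.range (Module.finrank F K), f (T^[i] w) * x ^ (Nat.card F ^ i) ≠ 0 := by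
    by_contra! hcon
    have : FiniteDimensional F K := inferInstance
    exact hfw (eq_zero_of_sum_mul_pow_card_eq_zero (F := F) (fun i => f (T^[i] w)) hcon
      Module.finrank_pos)
  refine ⟨∑ i ∈ Finset.range (Module.finrank F K), T^[i] (x • w), ?_, ?_, ?_⟩
  · refine W.sum_mem fun i _ => ?_
    rw [hsemi]
    exact W.smul_mem _ (hTW i)
  · have h1 : μ * τ (∑ i ∈ Finset.range (Module.finrank F K), T^[i] (x • w)) =
        ∑ i ∈ Finset.range (Module.finrank F K), T^[i + 1] (x • w) := by
      rw [map_sum, Finset.mul_sum]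
      exact Finset.sum_congr rfl fun i _ => (Function.iterate_succ_apply' T i _).symm
    have h2 := Finset.sum_range_succ (fun i => T^[i] (x • w)) (Module.finrank F K)
    rw [Finset.sum_range_succ', hT, Function.iterate_zero_apply] at h2
    rw [h1]
    exact add_right_cancel h2
  · intro hmem
    apply hx
    rw [← hfv _ hmem, map_sum]
    refine Finset.sum_congr rfl fun i _ => ?_
    rw [hsemi, map_smul, smul_eq_mul, mul_comm]

/-- Multiplying by an element of `K` turns the semilinear map `x ↦ μ τ(x)` into one of order
dividing `[K : F]`, provided that its `[K : F]`-th power is multiplication by an element of `K`: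
that element lies in `F`, and the norm of the extension `K / F` is surjective. -/
theorem exists_smul_iterate_eq_self (τ : E ≃ₐ[F] E)
    (hτK : ∀ k : K, τ (algebraMap K E k) = algebraMap K E (k ^ Nat.card F))
    (hτ : τ ^ Module.finrank F K = 1) {μ : E} (hμ : μ ≠ 0) {s : K}
    (hs : ∏ j ∈ Finset.range (Module.finrank F K), (τ ^ j) μ = algebraMap K E s) :
    ∃ k : K, k ≠ 0 ∧
      ∀ x, (fun x => (algebraMap K E k * μ) * τ x)^[Module.finrank F K] x = x := by
  have : Finite F := Finite.of_injective _ (algebraMap F K).injective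
  have : Fintype F := Fintype.ofFinite F
  have hs0 : s ≠ 0 := by
    rintro rfl
    rw [map_zero, Finset.prod_eq_zero_iff] at hs
    obtain ⟨j, -, hj⟩ := hs
    exact hμ ((map_eq_zero_iff _ (τ ^ j).injective).1 hj)
  have hsτ : τ (algebraMap K E s) = algebraMap K E s := by
    have h2 := Finset.prod_range_succ (fun i => (τ ^ i) μ) (Module.finrank F K)
    rw [Finset.prod_range_succ', hτ] at h2
    rw [← hs, map_prod]
    refine mul_right_cancel₀ hμ (Eq.trans ?_ h2)
    simp [pow_succ']
  rw [hτK] at hsτ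
  have hsF : s ^ Nat.card F = s := (algebraMap K E).injective hsτ
  obtain ⟨f, hf⟩ := mem_range_algebraMap_iff_pow_card_eq.2 hsF
  obtain ⟨k, hk⟩ := FiniteField.norm_surjective F K f⁻¹
  have hkn := FiniteField.algebraMap_norm_eq_prod_pow F K k
  rw [hk, map_inv₀, hf] at hkn
  refine ⟨k, ?_, fun x => ?_⟩
  · rintro rfl
    rw [Algebra.norm_zero] at hk
    have : f = 0 := by simpa using hk.symm
    rw [this, map_zero] at hf
    exact hs0 hf.symm
  · have hpow : ∀ j, (τ ^ j) (algebraMap K E k) = algebraMap K E (k ^ Nat.card F ^ j) := by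
      intro j
      induction j with
      | zero => simp
      | succ j ih => rw [pow_succ', AlgEquiv.mul_apply, ih, hτK, ← pow_mul, ← pow_succ]
    rw [iterate_mul_apply, hτ, AlgEquiv.one_apply]
    simp only [map_mul, Finset.prod_mul_distrib, hpow]
    rw [← map_prod, ← hkn, hs, ← map_mul, inv_mul_cancel₀ hs0, map_one, one_mul]

/-- If an automorphism of order dividing `[K : F]` that induces the Frobenius of `K / F` preserves
a projective linear set, then it fixes one of its points. This is the vanishing of the first
cohomology of `PGL(2, K)`. -/
theorem exists_fixed_mem_projLinSet (hKE : NoQuadratic K E) (τ : E ≃ₐ[F] E)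
    (hτK : ∀ k : K, τ (algebraMap K E k) = algebraMap K E (k ^ Nat.card F))
    (hτ : τ ^ Module.finrank F K = 1) {α : E} (hα : α ∉ Set.range (algebraMap K E))
    (hfix : τ '' projLinSet K α = projLinSet K α) : ∃ β ∈ projLinSet K α, τ β = β := by
  have hτα : τ α ∈ projLinSet K α := hfix ▸ ⟨α, self_mem_projLinSet α, rfl⟩
  obtain ⟨a, b, c, d, hdet, h⟩ := (mem_projLinSet_iff hα).1 hτα
  have hμ := denom_ne_zero hα hdet
  set μ := algebraMap K E c * α + algebraMap K E d with hμdef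
  let W : Submodule K E := Submodule.span K {α, 1}
  have memW : ∀ w, w ∈ W ↔ ∃ x y : K, algebraMap K E x * α + algebraMap K E y = w := by
    intro w
    simp only [W, Submodule.mem_span_pair, Algebra.smul_def, mul_one]
  have hW : ∀ w ∈ W, μ * τ w ∈ W := by
    intro w hw
    obtain ⟨x, y, rfl⟩ := (memW w).1 hw
    refine (memW _).2 ⟨x ^ Nat.card F * a + y ^ Nat.card F * c,
      x ^ Nat.card F * b + y ^ Nat.card F * d, ?_⟩
    simp only [map_add, map_mul, hτK]
    linear_combination -(algebraMap K E (x ^ Nat.card F)) * h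
      - (algebraMap K E (y ^ Nat.card F)) * hμdef
  have hαW : α ∈ W := Submodule.subset_span (by simp)
  have h1W : (1 : E) ∈ W := Submodule.subset_span (by simp)
  have hiter : ∀ (i : ℕ), ∀ w ∈ W, (fun x => μ * τ x)^[i] w ∈ W := by
    intro i
    induction i with
    | zero => exact fun w hw => hw
    | succ i ih => exact fun w hw => by rw [Function.iterate_succ_apply]; exact ih _ (hW w hw)
  -- the `[K : F]`-th power of `x ↦ μ τ(x)` is multiplication by an element that preserves `W`,
  -- and such an element lies in `K` because `α` is not quadratic
  obtain ⟨s, hs⟩ : ∃ s : K,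
      ∏ j ∈ Finset.range (Module.finrank F K), (τ ^ j) μ = algebraMap K E s := by
    have h1 := hiter (Module.finrank F K) 1 h1W
    have h2 := hiter (Module.finrank F K) α hαW
    rw [iterate_mul_apply, hτ, AlgEquiv.one_apply] at h1 h2
    obtain ⟨x, y, h1⟩ := (memW _).1 h1
    obtain ⟨x', y', h2⟩ := (memW _).1 h2
    rw [mul_one] at h1
    obtain ⟨hx, -, -⟩ := quadratic_eq_zero (a := x) (b := y - x') (c := -y') (hKE α hα) (by
      simp only [map_sub, map_neg]
      linear_combination α * h1 - h2)
    exact ⟨y, by rw [← h1, hx]; simp⟩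
  obtain ⟨k, hk, hT⟩ := exists_smul_iterate_eq_self τ hτK hτ hμ hs
  have hW' : ∀ w ∈ W, algebraMap K E k * μ * τ w ∈ W := fun w hw => by
    rw [mul_assoc, ← Algebra.smul_def]
    exact W.smul_mem _ (hW w hw)
  have hμ' : algebraMap K E k * μ ≠ 0 := mul_ne_zero ((map_ne_zero _).2 hk) hμ
  obtain ⟨v, hvW, hv, hv0⟩ := exists_fixed_notMem_span τ hτK _ hT W hW' 0 1 h1W (by simp)
  have hv0 : v ≠ 0 := by rintro rfl; exact hv0 (Submodule.zero_mem _)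
  obtain ⟨u, huW, hu⟩ : ∃ u ∈ W, u ∉ Submodule.span K {v} := by
    by_contra! hcon
    obtain ⟨x, hx⟩ := Submodule.mem_span_singleton.1 (hcon 1 h1W)
    obtain ⟨y, hy⟩ := Submodule.mem_span_singleton.1 (hcon α hαW)
    rw [Algebra.smul_def] at hx hy
    obtain ⟨h3, -⟩ := linear_eq_zero (c := x) (d := -y) hα (by
      rw [map_neg]
      linear_combination (-algebraMap K E x) * hy + algebraMap K E y * hx)
    rw [h3] at hx
    simp at hx
  obtain ⟨w, hwW, hw, hwv⟩ := exists_fixed_notMem_span τ hτK _ hT W hW' v u huW hu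
  obtain ⟨x, y, hxy⟩ := (memW v).1 hvW
  obtain ⟨x', y', hxy'⟩ := (memW w).1 hwW
  refine ⟨w / v, (mem_projLinSet_iff hα).2 ⟨x', y', x, y, ?_, ?_⟩, ?_⟩
  · intro h0
    apply hwv
    rw [Submodule.mem_span_singleton]
    by_cases hx : x = 0
    · have hy : y ≠ 0 := by
        rintro rfl
        apply hv0
        rw [← hxy, hx]
        simp
      have hx' : x' = 0 := by
        rw [hx, mul_zero, sub_zero] at h0
        exact (mul_eq_zero.1 h0).resolve_right hy
      refine ⟨y' / y, ?_⟩
      rw [← hxy, ← hxy', hx, hx', Algebra.smul_def, map_div₀]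
      have : algebraMap K E y ≠ 0 := (map_ne_zero _).2 hy
      field_simp
      simp [mul_comm]
    · refine ⟨x' / x, ?_⟩
      have : algebraMap K E x ≠ 0 := (map_ne_zero _).2 hx
      have h0' := congrArg (algebraMap K E) h0
      simp only [map_sub, map_mul, map_zero] at h0'
      rw [← hxy, ← hxy', Algebra.smul_def, map_div₀]
      field_simp
      linear_combination h0'
  · rw [hxy, hxy', div_mul_cancel₀ _ hv0]
  · conv_rhs => rw [← hv, ← hw]
    rw [map_div₀, mul_div_mul_left _ _ hμ']

end Descent

/-! ### Counting invariant projective linear sets -/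

section Counting

theorem card_eq_mul_of_card_fiber {A B : Type*} [Finite A] [Finite B] (f : A → B) (m : ℕ)
    (h : ∀ b, Nat.card {a // f a = b} = m) : Nat.card A = Nat.card B * m := by
  have := Fintype.ofFinite B
  rw [← Nat.card_congr (Equiv.sigmaFiberEquiv f), Nat.card_sigma]
  simp [h, Nat.card_eq_fintype_card]

variable {F K E : Type*} [Field F] [Field K] [Field E]
  [Algebra K E] [Algebra F E]

variable (K) in
/-- The projective linear sets of elements of `E` outside `K` that are invariant under `τ`. -/
def invariantSets (τ : E ≃ₐ[F] E) : Set (Set E) :=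
  {X | (∃ α : E, α ∉ Set.range (algebraMap K E) ∧ X = projLinSet K α) ∧ τ '' X = X}

variable (K) in
/-- The subfield of `K` fixed by an automorphism of `E`. -/
noncomputable def fixedSubfield (τ : E ≃ₐ[F] E) : Subfield K :=
  RingHom.eqLocusField ((τ : E →+* E).comp (algebraMap K E)) (algebraMap K E)

theorem mem_fixedSubfield {τ : E ≃ₐ[F] E} {k : K} :
    k ∈ fixedSubfield K τ ↔ τ (algebraMap K E k) = algebraMap K E k := Iff.rfl

variable [Finite K] [Algebra F K] [IsScalarTower F K E]

theorem apply_mem_range_algebraMap_iff (τ : E ≃ₐ[F] E) {x : E} :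
    τ x ∈ Set.range (algebraMap K E) ↔ x ∈ Set.range (algebraMap K E) := by
  constructor
  · rintro ⟨k, hk⟩
    refine ⟨τ.symm.restrictNormal K k, ?_⟩
    rw [AlgEquiv.restrictNormal_commutes, hk, AlgEquiv.symm_apply_apply]
  · rintro ⟨k, rfl⟩
    exact ⟨τ.restrictNormal K k, τ.restrictNormal_commutes K k⟩

/-- The points of `projLinSet K α` fixed by `τ` are obtained from the fixed point `α` by the
fractional linear transformations over the fixed subfield. -/
theorem card_fixed_points_of_projLinSet (hKE : NoQuadratic K E) (τ : E ≃ₐ[F] E) {α : E}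
    (hα : α ∉ Set.range (algebraMap K E)) (hτα : τ α = α) :
    Nat.card {β : E // τ β = β ∧ β ∈ projLinSet K α} =
      (Nat.card (fixedSubfield K τ) + 1) *
        ((Nat.card (fixedSubfield K τ) - 1) * Nat.card (fixedSubfield K τ)) := by
  set L := fixedSubfield K τ with hL
  let ι : Option L × Lˣ × L → Option K × Kˣ × K :=
    Prod.map (Option.map L.subtype) (Prod.map (Units.map L.subtype) L.subtype)
  have hι : Function.Injective ι :=
    (Option.map_injective L.subtype_injective).prodMap
      ((Units.map_injective L.subtype_injective).prodMap L.subtype_injective)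
  have hfix : ∀ p, τ (moebiusParam α (ι p)) = moebiusParam α (ι p) := by
    have h0 : ∀ y : L, τ (algebraMap K E y) = algebraMap K E y := fun y => y.2
    rintro ⟨_ | d, u, b⟩
    · simp [ι, moebiusParam, hτα, h0]
    · simp [ι, moebiusParam, hτα, h0]
  let g : Option L × Lˣ × L → {β : E // τ β = β ∧ β ∈ projLinSet K α} := fun p =>
    ⟨moebiusParam α (ι p), hfix p, range_moebiusParam hα ▸ ⟨_, rfl⟩⟩
  have hg : Function.Bijective g := by
    refine ⟨fun p p' h => hι (moebiusParam_injective hKE hα (congrArg Subtype.val h)), ?_⟩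
    rintro ⟨β, hβ, hβα⟩
    obtain ⟨p, rfl⟩ := (range_moebiusParam hα).symm ▸ hβα
    -- applying `τ` to the normal form gives a normal form of the same element
    have hs := τ.restrictNormal_commutes K
    set s := τ.restrictNormal K
    have memL : ∀ x : K, s x = x → x ∈ L := fun x hx => by
      rw [hL, mem_fixedSubfield, ← hs, hx]
    rcases p with ⟨_ | d, u, b⟩
    · have h1 : moebiusParam (K := K) α (none, Units.map (s : K →* K) u, s b) =
          moebiusParam α (none, u, b) := by
        rw [← hβ]
        simp [moebiusParam, hs, hτα]
      have h2 := moebiusParam_injective hKE hα h1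
      simp only [Prod.mk.injEq, true_and, Units.ext_iff] at h2
      have hu : (u : K) ∈ L := memL _ h2.1
      refine ⟨(none, Units.mk0 ⟨u, hu⟩ fun h => u.ne_zero (congrArg Subtype.val h),
        ⟨b, memL _ h2.2⟩), ?_⟩
      simp [g, ι, moebiusParam]
    · have h1 : moebiusParam (K := K) α (some (s d), Units.map (s : K →* K) u, s b) =
          moebiusParam α (some d, u, b) := by
        rw [← hβ]
        simp [moebiusParam, hs, hτα]
      have h2 := moebiusParam_injective hKE hα h1
      simp only [Prod.mk.injEq, Option.some.injEq, Units.ext_iff] at h2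
      have hu : (u : K) ∈ L := memL _ h2.2.1
      refine ⟨(some ⟨d, memL _ h2.1⟩,
        Units.mk0 ⟨u, hu⟩ fun h => u.ne_zero (congrArg Subtype.val h),
        ⟨b, memL _ h2.2.2⟩), ?_⟩
      simp [g, ι, moebiusParam]
  rw [← Nat.card_congr (Equiv.ofBijective g hg), Nat.card_prod, Nat.card_prod, Finite.card_option,
    Nat.card_units]

variable [Finite E]

/-- The number of `τ`-invariant projective linear sets, when each of them contains a fixed point
of `τ`. -/
theorem card_invariantSets (hKE : NoQuadratic K E) (τ : E ≃ₐ[F] E)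
    (hτ : ∀ α : E, α ∉ Set.range (algebraMap K E) → τ '' projLinSet K α = projLinSet K α →
      ∃ β ∈ projLinSet K α, τ β = β) {k e : ℕ} (hk : Nat.card {x : K // x ∈ fixedSubfield K τ} = k)
    (he : Nat.card {x : E // τ x = x} = e) :
    Nat.card (invariantSets K τ) * ((k + 1) * ((k - 1) * k)) + k = e := by
  classical
  have hsplit : Nat.card {x : E // τ x = x} =
      Nat.card {x : E // τ x = x ∧ x ∉ Set.range (algebraMap K E)} + k := by
    have h1 : Nat.card {x : E // τ x = x ∧ x ∈ Set.range (algebraMap K E)} = k := by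
      rw [← hk]
      refine (Nat.card_congr (Equiv.ofBijective
        (fun y : fixedSubfield K τ => (⟨algebraMap K E y, y.2, y.1, rfl⟩ :
          {x : E // τ x = x ∧ x ∈ Set.range (algebraMap K E)})) ⟨fun y y' h => ?_, ?_⟩)).symm
      · exact Subtype.ext ((algebraMap K E).injective (congrArg Subtype.val h))
      · rintro ⟨_, h, y, rfl⟩
        exact ⟨⟨y, h⟩, rfl⟩
    rw [← h1, ← Nat.card_sum]
    refine Nat.card_congr ((Equiv.sumCompl fun x : {x : E // τ x = x} =>
      x.1 ∉ Set.range (algebraMap K E)).symm.trans (Equiv.sumCongr ?_ ?_))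
    · exact Equiv.subtypeSubtypeEquivSubtypeInter (fun x : E => τ x = x)
        (fun x => x ∉ Set.range (algebraMap K E))
    · exact (Equiv.subtypeSubtypeEquivSubtypeInter (fun x : E => τ x = x)
        (fun x => ¬ x ∉ Set.range (algebraMap K E))).trans
        (Equiv.subtypeEquivRight fun x => by rw [not_not])
  rw [← he, hsplit]
  congr 1
  let f : {x : E // τ x = x ∧ x ∉ Set.range (algebraMap K E)} → invariantSets K τ := fun x =>
    ⟨projLinSet K x.1, ⟨x.1, x.2.2, rfl⟩, by rw [image_projLinSet, x.2.1]⟩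
  refine (card_eq_mul_of_card_fiber f _ ?_).symm
  rintro ⟨X, ⟨α, hα, rfl⟩, hX⟩
  obtain ⟨β, hβ, hβτ⟩ := hτ α hα hX
  have hβK := notMem_range_of_mem_projLinSet hα hβ
  have hfib := card_fixed_points_of_projLinSet hKE τ hβK hβτ
  rw [hk] at hfib
  rw [← hfib]
  refine Nat.card_congr ((Equiv.subtypeEquivRight fun x => Subtype.ext_iff).trans
    ((Equiv.subtypeSubtypeEquivSubtypeInter
      (fun x : E => τ x = x ∧ x ∉ Set.range (algebraMap K E))
      (fun x => projLinSet K x = projLinSet K α)).trans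
    (Equiv.subtypeEquivRight fun x => ?_)))
  rw [← (projLinSet_eq_iff hα).2 hβ, projLinSet_eq_iff hβK, and_assoc]
  exact and_congr_right fun _ => ⟨fun h => h.2, fun h =>
    ⟨notMem_range_of_mem_projLinSet hβK h, h⟩⟩

end Counting

/-! ### Projective linear sets invariant under the automorphism group of `E / K` -/

section Invariant

/-- The polynomials `U_k` with `U_0 = 0`, `U_1 = 1` and `U_{k+2} = U_{k+1} - X U_k`. The powers of
the matrix `A = !![0, -d; 1, 1]` are `A ^ k = U_k(d) A - d U_{k-1}(d)`. -/
noncomputable def powerPoly (K : Type*) [Field K] : ℕ → K[X]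
  | 0 => 0
  | 1 => 1
  | k + 2 => powerPoly K (k + 1) - Polynomial.X * powerPoly K k

theorem powerPoly_coeff_zero (K : Type*) [Field K] (k : ℕ) :
    (powerPoly K (k + 1)).coeff 0 = 1 := by
  induction k with
  | zero => simp [powerPoly]
  | succ k ih => simp [powerPoly, ih]

theorem natDegree_powerPoly_le (K : Type*) [Field K] (m : ℕ) :
    (powerPoly K (2 * m + 1)).natDegree ≤ m ∧ (powerPoly K (2 * m + 2)).natDegree ≤ m := by
  have step : ∀ {f g : K[X]} {a b : ℕ}, f.natDegree ≤ a → g.natDegree ≤ b → b + 1 ≤ a →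
      (f - Polynomial.X * g).natDegree ≤ a := by
    intro f g a b hf hg hab
    refine (Polynomial.natDegree_sub_le _ _).trans (max_le hf ?_)
    refine Polynomial.natDegree_mul_le.trans ?_
    rw [Polynomial.natDegree_X]
    omega
  induction m with
  | zero => simp [powerPoly]
  | succ m ih =>
    have h1 : (powerPoly K (2 * m + 3)).natDegree ≤ m + 1 :=
      step (ih.2.trans (Nat.le_succ m)) ih.1 le_rfl
    exact ⟨h1, step h1 ih.2 le_rfl⟩

variable {F K E : Type*} [Field F] [Field K] [Field E] [Algebra K E] [Algebra F E]

/-- The constant `d` in the normal form `τ x = -d / (x + 1)` determines the projective linear set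
of `x`. -/
theorem mem_projLinSet_of_apply_mul (τ : E ≃ₐ[F] E)
    (hτK : ∀ x, τ x = x ↔ x ∈ Set.range (algebraMap K E)) {α β : E}
    (hα : α ∉ Set.range (algebraMap K E)) (hβ : β ∉ Set.range (algebraMap K E)) {d : K}
    (hαd : τ α * (α + 1) = -algebraMap K E d) (hβd : τ β * (β + 1) = -algebraMap K E d) :
    β ∈ projLinSet K α := by
  by_cases hne : β = α
  · exact hne ▸ self_mem_projLinSet β
  have hα1 : α + 1 ≠ 0 := by simpa using add_algebraMap_ne_zero hα (1 : K)
  have hβ1 : β + 1 ≠ 0 := by simpa using add_algebraMap_ne_zero hβ (1 : K)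
  have hd : algebraMap K E d ≠ 0 := by
    intro h0
    rw [h0, neg_zero, mul_eq_zero, or_iff_left hα1] at hαd
    rw [map_eq_zero_iff τ τ.injective] at hαd
    exact hα ⟨0, by rw [hαd, map_zero]⟩
  have hsub : β - α ≠ 0 := sub_ne_zero.2 hne
  -- the transformation sought commutes with `x ↦ -d / (x + 1)`, so its matrix is
  -- `u + !![0, -d; 1, 1]`; the equation for `u` is invariant under `τ`
  obtain ⟨u, hu⟩ : -(algebraMap K E d + β + α * β) / (β - α) ∈ Set.range (algebraMap K E) := by
    rw [← hτK]
    have h1 : τ α = -algebraMap K E d / (α + 1) := by rw [eq_div_iff hα1, hαd]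
    have h2 : τ β = -algebraMap K E d / (β + 1) := by rw [eq_div_iff hβ1, hβd]
    have hsub' : τ β - τ α ≠ 0 := by
      rw [← map_sub]; exact (map_ne_zero_iff τ τ.injective).2 hsub
    simp only [map_div₀, map_neg, map_add, map_mul, map_sub, (hτK _).2 ⟨d, rfl⟩]
    rw [div_eq_div_iff hsub' hsub, h1, h2]
    field_simp
    ring
  rw [eq_div_iff hsub] at hu
  refine (mem_projLinSet_iff hα).2 ⟨u, -d, 1, u + 1, ?_, ?_⟩
  · intro hdet
    -- a singular matrix would map `α` to `u`
    have hdet' := congrArg (algebraMap K E) hdet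
    simp only [map_sub, map_mul, map_add, map_one, map_neg, map_zero] at hdet'
    have h1 : α + algebraMap K E (u + 1) ≠ 0 := add_algebraMap_ne_zero hα _
    refine hβ ⟨u, mul_right_cancel₀ h1 ?_⟩
    simp only [map_add, map_one]
    linear_combination hdet' - hu
  · simp only [map_neg, map_one, map_add]
    linear_combination hu

/-- The powers of `τ` act on a point in normal form through the powers of the matrix
`!![0, -d; 1, 1]`. -/
theorem pow_apply_mul (τ : E ≃ₐ[F] E)
    (hτK : ∀ x, τ x = x ↔ x ∈ Set.range (algebraMap K E)) {α : E} {d : K}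
    (hαd : τ α * (α + 1) = -algebraMap K E d) (k : ℕ) :
    (τ ^ (k + 1)) α * (algebraMap K E ((powerPoly K (k + 1)).eval d) * α +
        algebraMap K E ((powerPoly K (k + 2)).eval d)) =
      -algebraMap K E d * (algebraMap K E ((powerPoly K k).eval d) * α +
        algebraMap K E ((powerPoly K (k + 1)).eval d)) := by
  have hpow : ∀ k : ℕ, (τ ^ (k + 1)) α * ((τ ^ k) α + 1) = -algebraMap K E d := by
    intro k
    induction k with
    | zero => simpa using hαd
    | succ k ih =>
      have := congrArg τ ih
      simpa only [map_mul, map_add, map_one, map_neg, ← AlgEquiv.mul_apply, ← pow_succ',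
        (hτK _).2 ⟨d, rfl⟩] using this
  have hrec : ∀ k, algebraMap K E ((powerPoly K (k + 2)).eval d) =
      algebraMap K E ((powerPoly K (k + 1)).eval d) -
        algebraMap K E d * algebraMap K E ((powerPoly K k).eval d) := by
    intro k
    simp [powerPoly]
  induction k with
  | zero => simpa [powerPoly] using hαd
  | succ k ih =>
    rw [hrec (k + 1), hrec k] at *
    linear_combination (hpow (k + 1)) * (algebraMap K E (Polynomial.eval d (powerPoly K (k + 1))) *
      α + (algebraMap K E (Polynomial.eval d (powerPoly K (k + 1))) - algebraMap K E d *
        algebraMap K E (Polynomial.eval d (powerPoly K k)))) - (τ ^ (k + 1 + 1)) α * ih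

/-- The relation `τ ^ r = 1` turns `pow_apply_mul` into a quadratic equation for `α` over `K` with
leading coefficient `U_r(d)`. -/
theorem powerPoly_eval_eq_zero (hKE : NoQuadratic K E) (τ : E ≃ₐ[F] E)
    (hτK : ∀ x, τ x = x ↔ x ∈ Set.range (algebraMap K E)) {r : ℕ} (hr : 0 < r) (hτr : τ ^ r = 1)
    {α : E} (hα : α ∉ Set.range (algebraMap K E)) {d : K}
    (hαd : τ α * (α + 1) = -algebraMap K E d) : (powerPoly K r).eval d = 0 := by
  obtain ⟨k, rfl⟩ := Nat.exists_eq_succ_of_ne_zero hr.ne'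
  have h := pow_apply_mul τ hτK hαd k
  rw [hτr, AlgEquiv.one_apply] at h
  refine (quadratic_eq_zero (a := (powerPoly K (k + 1)).eval d)
    (b := (powerPoly K (k + 2)).eval d + d * (powerPoly K k).eval d)
    (c := d * (powerPoly K (k + 1)).eval d) (hKE α hα) ?_).1
  simp only [map_add, map_mul]
  linear_combination h

variable [Finite K] [Algebra F K] [IsScalarTower F K E]

/-- An odd-order automorphism with fixed field `K` that maps a projective linear set to itself
acts on one of its points by `x ↦ -d / (x + 1)`. -/
theorem exists_mem_projLinSet_apply_mul (τ : E ≃ₐ[F] E)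
    (hτK : ∀ x, τ x = x ↔ x ∈ Set.range (algebraMap K E)) {r : ℕ} (hr : Odd r) (hτr : τ ^ r = 1)
    {α : E} (hα : α ∉ Set.range (algebraMap K E)) (hfix : τ '' projLinSet K α = projLinSet K α) :
    ∃ β ∈ projLinSet K α, ∃ d : K, τ β * (β + 1) = -algebraMap K E d := by
  have hτk : ∀ k : K, τ (algebraMap K E k) = algebraMap K E k := fun k => (hτK _).2 ⟨k, rfl⟩
  -- after a translation and an inversion the transformation does not fix infinity
  obtain ⟨β, hβ, a, b, c, d, hdet, h, hc⟩ : ∃ β ∈ projLinSet K α, ∃ a b c d : K,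
      a * d - b * c ≠ 0 ∧ τ β * (algebraMap K E c * β + algebraMap K E d) =
        algebraMap K E a * β + algebraMap K E b ∧ c ≠ 0 := by
    have hτα : τ α ∈ projLinSet K α := hfix ▸ ⟨α, self_mem_projLinSet α, rfl⟩
    obtain ⟨a, b, c, d, hdet, h⟩ := (mem_projLinSet_iff hα).1 hτα
    by_cases hc : c = 0
    · subst hc
      obtain ⟨s, hs⟩ : ∃ s : K, b + s * (d - a) ≠ 0 := by
        by_contra! hcon
        have hb : b = 0 := by simpa using hcon 0
        have had : d = a := by simpa [hb, sub_eq_zero] using hcon 1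
        subst hb had
        have hd : algebraMap K E d ≠ 0 := by
          rw [map_ne_zero]; rintro rfl; simp at hdet
        apply hα
        rw [← hτK]
        apply mul_right_cancel₀ hd
        simp only [map_zero, zero_mul, zero_add, add_zero] at h
        rw [h, mul_comm]
      have h1 := add_algebraMap_ne_zero hα s
      have h2 : τ α + algebraMap K E s ≠ 0 := by
        rw [← hτk s, ← map_add]
        exact (map_ne_zero_iff τ τ.injective).2 h1
      refine ⟨1 / (α + algebraMap K E s), (mem_projLinSet_iff hα).2 ⟨0, 1, 1, s, by simp, by
        simp [h1]⟩, d, 0, b + s * (d - a), a, ?_, ?_, hs⟩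
      · convert hdet using 1
        ring
      · simp only [map_div₀, map_one, map_add, hτk, map_mul, map_sub, map_zero]
        field_simp
        simp only [map_zero, zero_mul, zero_add] at h
        linear_combination -h
    · exact ⟨α, self_mem_projLinSet α, a, b, c, d, hdet, h, hc⟩
  have hβK := notMem_range_of_mem_projLinSet hα hβ
  have hc' : algebraMap K E c ≠ 0 := (map_ne_zero _).2 hc
  -- a vanishing trace would make `τ` an involution on `β`
  have htr : a + d ≠ 0 := by
    intro h0
    have hd : d = -a := by linear_combination h0
    subst hd
    have h1 := congrArg τ h
    simp only [map_mul, map_add, hτk] at h1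
    have hden : algebraMap K E c * τ β + algebraMap K E (-a) ≠ 0 :=
      denom_ne_zero (fun h => hβK ((apply_mem_range_algebraMap_iff τ).1 h)) hdet
    have h2 : τ (τ β) = β := by
      apply mul_right_cancel₀ hden
      rw [h1]
      simp only [map_neg] at h ⊢
      linear_combination -h
    have h3 : ∀ m : ℕ, (τ ^ (2 * m)) β = β := by
      intro m
      induction m with
      | zero => simp
      | succ m ih =>
        rw [show 2 * (m + 1) = 2 * m + 1 + 1 by ring, pow_succ, pow_succ, AlgEquiv.mul_apply,
          AlgEquiv.mul_apply, h2, ih]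
    obtain ⟨m, rfl⟩ := hr
    have h4 : τ ((τ ^ (2 * m)) β) = β := by
      rw [← AlgEquiv.mul_apply, ← pow_succ', hτr, AlgEquiv.one_apply]
    rw [h3] at h4
    exact hβK ((hτK β).1 h4)
  have htr' : algebraMap K E (a + d) ≠ 0 := (map_ne_zero _).2 htr
  -- translate so that infinity is mapped to zero, then rescale so that the pole is `-1`
  refine ⟨(algebraMap K E c * β - algebraMap K E a) / algebraMap K E (a + d),
    mem_projLinSet_trans hα hβ ((mem_projLinSet_iff hβK).2 ⟨c, -a, 0, a + d, ?_, ?_⟩),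
    (a * d - b * c) / (a + d) ^ 2, ?_⟩
  · simpa using ⟨hc, htr⟩
  · rw [map_zero, zero_mul, zero_add, div_mul_cancel₀ _ htr', map_neg]
    ring
  · simp only [map_div₀, map_sub, map_mul, hτk, map_pow]
    field_simp
    simp only [map_add]
    linear_combination (algebraMap K E c) * h

/-- At most `(r - 1) / 2` projective linear sets are invariant under an automorphism of odd order
`r` with fixed field `K`: each determines a root of `powerPoly K r`. -/
theorem card_invariantSets_le (hKE : NoQuadratic K E) (τ : E ≃ₐ[F] E)
    (hτK : ∀ x, τ x = x ↔ x ∈ Set.range (algebraMap K E)) (m : ℕ) (hτr : τ ^ (2 * m + 1) = 1) :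
    Nat.card (invariantSets K τ) ≤ m := by
  classical
  have key : ∀ X : invariantSets K τ, ∃ β : E, β ∉ Set.range (algebraMap K E) ∧
      X.1 = projLinSet K β ∧ ∃ d : K, τ β * (β + 1) = -algebraMap K E d := by
    rintro ⟨X, ⟨α, hα, rfl⟩, hX⟩
    obtain ⟨β, hβ, hd⟩ := exists_mem_projLinSet_apply_mul τ hτK ⟨m, rfl⟩ hτr hα hX
    exact ⟨β, notMem_range_of_mem_projLinSet hα hβ, ((projLinSet_eq_iff hα).2 hβ).symm, hd⟩
  choose β hβK hβX d hd using key
  have hne : powerPoly K (2 * m + 1) ≠ 0 := by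
    intro h0
    have := powerPoly_coeff_zero K (2 * m)
    rw [h0] at this
    simp at this
  let f : invariantSets K τ → (powerPoly K (2 * m + 1)).roots.toFinset := fun X => ⟨d X, by
    rw [Multiset.mem_toFinset, Polynomial.mem_roots hne]
    exact powerPoly_eval_eq_zero hKE τ hτK (by omega) hτr (hβK X) (hd X)⟩
  have hf : Function.Injective f := by
    intro X Y h
    have hdd : d X = d Y := congrArg Subtype.val h
    have h1 := hd Y
    rw [← hdd] at h1
    have := mem_projLinSet_of_apply_mul τ hτK (hβK X) (hβK Y) (hd X) h1
    exact Subtype.ext (by rw [hβX X, hβX Y, (projLinSet_eq_iff (hβK X)).2 this])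
  calc Nat.card (invariantSets K τ)
      ≤ Nat.card (powerPoly K (2 * m + 1)).roots.toFinset := Nat.card_le_card_of_injective f hf
    _ = (powerPoly K (2 * m + 1)).roots.toFinset.card :=
        Nat.card_eq_fintype_card.trans (Fintype.card_coe _)
    _ ≤ (powerPoly K (2 * m + 1)).natDegree :=
        (Multiset.toFinset_card_le _).trans (Polynomial.card_roots' _)
    _ ≤ m := (natDegree_powerPoly_le K m).1

end Invariant

/-! ### Orbits of a cyclic group whose order is a product of two primes -/

section Burnside

/-- A cyclic group has at most `m` elements `x` with `x ^ m = 1`; for `m = orderOf g` the powers of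
`g` account for all of them. -/
theorem mem_zpowers_of_pow_orderOf_eq_one {G : Type*} [Group G] [Finite G] [IsCyclic G] {g x : G}
    (h : x ^ orderOf g = 1) : x ∈ Subgroup.zpowers g := by
  classical
  have := Fintype.ofFinite G
  have hsub : (Finset.univ.filter fun y => y ∈ Subgroup.zpowers g) ⊆
      Finset.univ.filter fun y => y ^ orderOf g = 1 := by
    intro y hy
    simp only [Finset.mem_filter_univ] at hy ⊢
    exact orderOf_dvd_iff_pow_eq_one.1 (orderOf_dvd_of_mem_zpowers hy)
  have hcard : (Finset.univ.filter fun y => y ∈ Subgroup.zpowers g).card = orderOf g := by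
    rw [← Nat.card_zpowers g, Nat.card_eq_fintype_card, Fintype.card_subtype]
  have heq := Finset.eq_of_subset_of_card_le hsub
    ((IsCyclic.card_pow_eq_one_le (orderOf_pos g)).trans_eq hcard.symm)
  have : x ∈ Finset.univ.filter fun y => y ∈ Subgroup.zpowers g := by
    rw [heq]
    simpa using h
  simpa using this

theorem zpowers_eq_of_orderOf_eq {G : Type*} [Group G] [Finite G] [IsCyclic G] {g h : G}
    (hgh : orderOf g = orderOf h) : Subgroup.zpowers g = Subgroup.zpowers h := by
  refine le_antisymm ?_ ?_ <;> rw [Subgroup.zpowers_le] <;>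
    apply mem_zpowers_of_pow_orderOf_eq_one
  · rw [← hgh, pow_orderOf_eq_one]
  · rw [hgh, pow_orderOf_eq_one]

theorem sum_orderOf_of_card_eq_mul {G : Type*} [Group G] [Fintype G] [IsCyclic G] {n r : ℕ}
    (hn : n.Prime) (hr : r.Prime) (hnr : n ≠ r) (hG : Fintype.card G = n * r) (f : ℕ → ℕ) :
    ∑ g : G, f (orderOf g) = f 1 + (n - 1) * f n + (r - 1) * f r +
      (n - 1) * (r - 1) * f (n * r) := by
  classical
  have h1 : ∑ g : G, f (orderOf g) = ∑ d ∈ (n * r).divisors, d.totient * f d := by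
    rw [← Finset.sum_fiberwise_of_maps_to (t := (n * r).divisors) (g := fun g : G => orderOf g)]
    · refine Finset.sum_congr rfl fun d hd => ?_
      rw [← IsCyclic.card_orderOf_eq_totient (α := G) (hG ▸ Nat.dvd_of_mem_divisors hd),
        ← smul_eq_mul, ← Finset.sum_const]
      exact Finset.sum_congr rfl fun g hg => by rw [(Finset.mem_filter.1 hg).2]
    · intro g _
      rw [Nat.mem_divisors, ← hG]
      exact ⟨orderOf_dvd_card, Fintype.card_ne_zero⟩
  have hcop : Nat.Coprime n r := (Nat.coprime_primes hn hr).2 hnr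
  have hdiv : (n * r).divisors = {1, n, r, n * r} := by
    rw [Nat.divisors_mul, hn.divisors, hr.divisors]
    ext x
    simp only [Finset.mem_mul, Finset.mem_insert, Finset.mem_singleton]
    constructor
    · rintro ⟨a, rfl | rfl, b, rfl | rfl, rfl⟩ <;> simp
    · rintro (rfl | rfl | rfl | rfl)
      · exact ⟨1, .inl rfl, 1, .inl rfl, rfl⟩
      · exact ⟨x, .inr rfl, 1, .inl rfl, mul_one _⟩
      · exact ⟨1, .inl rfl, x, .inr rfl, one_mul _⟩
      · exact ⟨n, .inr rfl, r, .inr rfl, rfl⟩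
  have hn1 := hn.one_lt
  have hr1 := hr.one_lt
  have h1n : 1 ≠ n := hn1.ne
  have h1r : 1 ≠ r := hr1.ne
  have h1nr : 1 ≠ n * r := (one_lt_mul'' hn1 hr1).ne
  have hnnr : n ≠ n * r := by nlinarith
  have hrnr : r ≠ n * r := by nlinarith
  rw [h1, hdiv, Finset.sum_insert (by
      simp only [Finset.mem_insert, Finset.mem_singleton]; tauto),
    Finset.sum_insert (by simp only [Finset.mem_insert, Finset.mem_singleton]; tauto),
    Finset.sum_insert (by simp only [Finset.mem_singleton]; tauto), Finset.sum_singleton,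
    Nat.totient_one, Nat.totient_mul hcop, Nat.totient_prime hn, Nat.totient_prime hr]
  ring

theorem card_modEq_card_fixed {A : Type*} [Finite A] {p : ℕ} (hp : p.Prime) (f : A → A)
    (hf : ∀ x, f^[p] x = x) : Nat.card A ≡ Nat.card {x // f x = x} [MOD p] := by
  classical
  have := Fintype.ofFinite A
  have : Fact p.Prime := ⟨hp⟩
  have h := Equiv.Perm.card_fixedPoints_modEq (α := A) (f := f) (p := p) (n := 1) (by
    rw [pow_one]
    funext x
    exact (congrFun (hom_coe_pow (fun g : Function.End A => (g : A → A)) rfl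
      (fun _ _ => rfl) f p) x).trans (hf x))
  rw [Nat.card_eq_fintype_card, Nat.card_eq_fintype_card]
  convert h using 2
  rfl

variable {F K E : Type*} [Field F] [Field K] [Field E] [Algebra K E] [Algebra F E]

theorem mem_invariantSets_iff_mem_stabilizer {τ : E ≃ₐ[F] E} {X : Set E} :
    X ∈ invariantSets K τ ↔ (∃ α : E, α ∉ Set.range (algebraMap K E) ∧ X = projLinSet K α) ∧
      τ ∈ MulAction.stabilizer (E ≃ₐ[F] E) X := Iff.rfl

theorem invariantSets_subset {τ ρ : E ≃ₐ[F] E} (h : ρ ∈ Subgroup.zpowers τ) :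
    invariantSets K τ ⊆ invariantSets K ρ := by
  intro X hX
  rw [mem_invariantSets_iff_mem_stabilizer] at hX ⊢
  exact ⟨hX.1, Subgroup.zpowers_le.2 hX.2 h⟩

theorem invariantSets_mul (τ ρ : E ≃ₐ[F] E) :
    invariantSets K τ ∩ invariantSets K ρ ⊆ invariantSets K (τ * ρ) := by
  rintro X ⟨h1, h2⟩
  rw [mem_invariantSets_iff_mem_stabilizer] at *
  exact ⟨h1.1, Subgroup.mul_mem _ h1.2 h2.2⟩

/-- An automorphism `ρ` of prime order `r` commuting with `τ` permutes the `τ`-invariant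
projective linear sets, so modulo `r` their number is that of the sets invariant under both. -/
theorem card_invariantSets_modEq [Finite K] [Finite E] [Algebra F K] [IsScalarTower F K E]
    {r : ℕ} (hr : r.Prime) (τ ρ : E ≃ₐ[F] E) (hρ : ρ ^ r = 1) (hcomm : Commute τ ρ) :
    Nat.card (invariantSets K τ) ≡
      Nat.card ↥(invariantSets K τ ∩ invariantSets K ρ) [MOD r] := by
  let f : invariantSets K τ → invariantSets K τ := fun X => ⟨ρ '' X.1, by
    obtain ⟨X, ⟨α, hα, rfl⟩, hX⟩ := X
    refine ⟨⟨ρ α, fun h => hα ((apply_mem_range_algebraMap_iff ρ).1 h), image_projLinSet ρ α⟩, ?_⟩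
    change τ • ρ • projLinSet K α = ρ • projLinSet K α
    rw [smul_smul, hcomm.eq, ← smul_smul]
    exact congrArg (ρ • ·) hX⟩
  have hf : ∀ (k : ℕ) (X : invariantSets K τ), (f^[k] X).1 = ρ ^ k • X.1 := by
    intro k
    induction k with
    | zero => intro X; rw [pow_zero, one_smul]; rfl
    | succ k ih =>
      intro X
      rw [Function.iterate_succ_apply, ih, pow_succ, ← smul_smul]
      rfl
  refine (card_modEq_card_fixed hr f fun X => Subtype.ext ?_).trans (congrArg (· % r) ?_)
  · rw [hf, hρ, one_smul]
  · refine Nat.card_congr ((Equiv.subtypeEquivRight fun X => Subtype.ext_iff).trans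
      ((Equiv.subtypeSubtypeEquivSubtypeInter (fun X => X ∈ invariantSets K τ)
        (fun X => ρ '' X = X)).trans (Equiv.subtypeEquivRight fun X => ?_)))
    exact ⟨fun h => ⟨h.1, h.1.1, h.2⟩, fun h => ⟨h.1, h.2.2⟩⟩

/-- **Burnside's lemma** for the action of the Frobenius group on the projective linear sets. -/
theorem sum_card_invariantSets [Fintype F] [Finite K] [Finite E] [Algebra F K]
    [IsScalarTower F K E] {r : ℕ} (hr : r.Prime) (hfin : Module.finrank K E = r)
    [Fintype (frobGroup F E)] :
    ∑ g : frobGroup F E, Nat.card (invariantSets K (g : E ≃ₐ[F] E)) =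
      numOrbits F K E r * Fintype.card (frobGroup F E) := by
  classical
  have := Fintype.ofFinite (projLinSets F K E r)
  have := Fintype.ofFinite
    (MulAction.orbitRel.Quotient (frobGroup F E) (projLinSets F K E r))
  have h := MulAction.sum_card_fixedBy_eq_card_orbits_mul_card_group (frobGroup F E)
    (projLinSets F K E r)
  rw [numOrbits, Nat.card_eq_fintype_card]
  refine Eq.trans (Finset.sum_congr rfl fun g _ => ?_) h
  rw [← Nat.card_eq_fintype_card]
  refine Nat.card_congr (Equiv.trans ?_ (Equiv.symm
    ((Equiv.subtypeEquivRight fun X => Subtype.ext_iff).trans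
    (Equiv.subtypeSubtypeEquivSubtypeInter (fun X : Set E => X ∈ projLinSets F K E r)
      (fun X => g • X = X)))))
  refine Equiv.subtypeEquivRight fun X => and_congr_left fun _ => ?_
  change _ ↔ ∃ α ∈ degreeSet K E r, X = projLinSet K α
  simp only [mem_degreeSet_iff hr hfin]

end Burnside

/-! ### The orbit count -/

section OrbitCount

theorem finrank_eq_of_card {F K : Type*} [Field F] [Field K] [Finite K] [Algebra F K] {m : ℕ}
    (h : Nat.card K = Nat.card F ^ m) : Module.finrank F K = m := by
  have : Finite F := Finite.of_injective _ (algebraMap F K).injective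
  have h1 := Module.natCard_eq_pow_finrank (K := F) (V := K)
  rw [h] at h1
  exact (Nat.pow_right_injective Finite.one_lt_card h1).symm

theorem card_fixed_eq_pow {F E : Type*} [Field F] [Field E] [Finite E] [Algebra F E]
    {n r : ℕ} (hn : 0 < n) (hFE : Module.finrank F E = n * r)
    (τ : E ≃ₐ[F] E) (hτ : orderOf τ = n) : Nat.card {x : E // τ x = x} = Nat.card F ^ r := by
  let L := IntermediateField.fixedField (Subgroup.zpowers τ)
  have h1 : Module.finrank L E = n := by
    rw [IntermediateField.finrank_fixedField_eq_card, Nat.card_zpowers, hτ]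
  have h2 := Module.finrank_mul_finrank F L E
  rw [h1, hFE, mul_comm] at h2
  rw [← Nat.eq_of_mul_eq_mul_left hn h2, ← Module.natCard_eq_pow_finrank (K := F) (V := L)]
  refine Nat.card_congr (Equiv.subtypeEquivRight fun x => ?_)
  change _ ↔ x ∈ IntermediateField.fixedField (Subgroup.zpowers τ)
  rw [IntermediateField.mem_fixedField_iff]
  refine ⟨fun h f hf => ?_, fun h => h τ (Subgroup.mem_zpowers τ)⟩
  have : τ ∈ MulAction.stabilizer (E ≃ₐ[F] E) x := h
  exact Subgroup.zpowers_le.2 this hf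

variable {F K E : Type*} [Field F] [Field K] [Finite K]
  [Field E] [Finite E] [Algebra F K] [Algebra K E] [Algebra F E] [IsScalarTower F K E]

/-- The orbit count in terms of the numbers `N`, `b`, `a`, `c` of projective linear sets invariant
under Frobenius automorphisms of order `1`, `n`, `r`, `n * r`. -/
theorem exists_orbit_count [Fintype F] {n r q : ℕ} (hn : n.Prime) (hr : r.Prime)
    (hr2 : 2 < r) (hnr : n ≠ r)
    (hF : Nat.card F = q) (hK : Nat.card K = q ^ n) (hE : Nat.card E = q ^ (n * r)) :
    ∃ N b a c : ℕ, N * ((q ^ n + 1) * ((q ^ n - 1) * q ^ n)) + q ^ n = (q ^ n) ^ r ∧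
      b * ((q + 1) * ((q - 1) * q)) + q = q ^ r ∧
      N ≡ a [MOD r] ∧ b ≡ c [MOD r] ∧ c ≤ a ∧ 2 * a + 1 ≤ r ∧
      N + (n - 1) * b + (r - 1) * a + (n - 1) * (r - 1) * c = numOrbits F K E r * (n * r) := by
  subst hF
  have hFK : Module.finrank F K = n := finrank_eq_of_card hK
  have hKE : Module.finrank K E = r := finrank_eq_of_card (by rw [hE, hK, pow_mul])
  have hFE : Module.finrank F E = n * r := finrank_eq_of_card hE
  have hnq := noQuadratic_of_finrank hr hr2 hKE
  set σ := FiniteField.frobeniusAlgEquivOfAlgebraic F E with hσ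
  have hσo : orderOf σ = n * r := by
    rw [FiniteField.orderOf_frobeniusAlgEquivOfAlgebraic, hFE]
  have hσapply : ∀ (i : ℕ) (x : E), (σ ^ i) x = x ^ Nat.card F ^ i := fun i x => by
    rw [AlgEquiv.coe_pow, FiniteField.coe_frobeniusAlgEquivOfAlgebraic_iterate,
      Nat.card_eq_fintype_card]
  -- write `σ = τ ρ` with `τ` of order `n` and `ρ` of order `r`
  obtain ⟨u, v, huv⟩ := Nat.isCoprime_iff_coprime.2 ((Nat.coprime_primes hn hr).2 hnr)
  set ρ := (σ ^ n) ^ u with hρ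
  set τ := (σ ^ r) ^ v with hτ
  have hσnr : σ ^ (n * r) = 1 := hσo ▸ pow_orderOf_eq_one σ
  have hρr : ρ ^ r = 1 := by
    rw [hρ, ← zpow_natCast, zpow_comm, zpow_natCast, ← pow_mul, hσnr, one_zpow]
  have hτn : τ ^ n = 1 := by
    rw [hτ, ← zpow_natCast, zpow_comm, zpow_natCast, ← pow_mul, mul_comm, hσnr, one_zpow]
  have hτρ : τ * ρ = σ := by
    rw [hτ, hρ, ← zpow_natCast, ← zpow_natCast, ← zpow_mul, ← zpow_mul, ← zpow_add,
      show (r : ℤ) * v + n * u = 1 by linarith, zpow_one]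
  have hcomm : Commute τ ρ := by
    have h : Commute (σ ^ r) (σ ^ n) := Commute.pow_pow (Commute.refl σ) r n
    exact (h.zpow_left v).zpow_right u
  have hσn : σ ^ n = ρ ^ n := by rw [← hτρ, hcomm.mul_pow, hτn, one_mul]
  have hσr : σ ^ r = τ ^ r := by rw [← hτρ, hcomm.mul_pow, hρr, mul_one]
  have hρo : orderOf ρ = r := by
    refine orderOf_eq_prime_iff (hp := ⟨hr⟩).2 ⟨hρr, fun h => ?_⟩
    rw [h, one_pow] at hσn
    have := Nat.le_of_dvd hn.pos (hσo ▸ orderOf_dvd_of_pow_eq_one hσn)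
    nlinarith [hn.pos]
  have hτo : orderOf τ = n := by
    refine orderOf_eq_prime_iff (hp := ⟨hn⟩).2 ⟨hτn, fun h => ?_⟩
    rw [h, one_pow] at hσr
    have := Nat.le_of_dvd hr.pos (hσo ▸ orderOf_dvd_of_pow_eq_one hσr)
    nlinarith [hr.pos, hn.two_le]
  have hσnK : ∀ x : E, (σ ^ n) x = x ↔ x ∈ Set.range (algebraMap K E) := fun x => by
    rw [hσapply, ← hK, mem_range_algebraMap_iff_pow_card_eq]
  have hρK : ∀ x : E, ρ x = x ↔ x ∈ Set.range (algebraMap K E) := fun x => by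
    rw [← hσnK]
    constructor
    · intro h
      rw [hσn]
      exact (MulAction.stabilizer (E ≃ₐ[F] E) x).pow_mem h n
    · intro h
      exact (MulAction.stabilizer (E ≃ₐ[F] E) x).zpow_mem h u
  have hτK : ∀ k : K, τ (algebraMap K E k) = algebraMap K E (k ^ Nat.card F) := fun k => by
    have h := hσapply 1 (algebraMap K E k)
    rw [pow_one, pow_one, ← hτρ, AlgEquiv.mul_apply, (hρK _).2 ⟨k, rfl⟩] at h
    rw [h, map_pow]
  obtain ⟨m, hm⟩ := hr.odd_of_ne_two hr2.ne'
  have := Fintype.ofFinite (frobGroup F E)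
  have hG : Fintype.card (frobGroup F E) = n * r := by
    rw [← Nat.card_eq_fintype_card, frobGroup, Nat.card_zpowers, ← hσ, hσo]
  have hτfix : Nat.card {x : K // x ∈ fixedSubfield K τ} = Nat.card F := by
    rw [← Nat.card_range_of_injective (algebraMap F K).injective]
    refine Nat.card_congr (Equiv.subtypeEquivRight fun x => ?_)
    rw [mem_fixedSubfield, hτK, (algebraMap K E).injective.eq_iff,
      mem_range_algebraMap_iff_pow_card_eq]
  have hσρ : ρ ∈ Subgroup.zpowers σ :=
    Subgroup.zpow_mem _ (Subgroup.pow_mem _ (Subgroup.mem_zpowers σ) n) u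
  have hστ : τ ∈ Subgroup.zpowers σ :=
    Subgroup.zpow_mem _ (Subgroup.pow_mem _ (Subgroup.mem_zpowers σ) r) v
  have hinter : invariantSets K τ ∩ invariantSets K ρ = invariantSets K σ := by
    refine Set.Subset.antisymm ?_ ?_
    · conv_rhs => rw [← hτρ]
      exact invariantSets_mul τ ρ
    · exact Set.subset_inter (invariantSets_subset hστ) (invariantSets_subset hσρ)
  refine ⟨Nat.card (invariantSets K (1 : E ≃ₐ[F] E)), Nat.card (invariantSets K τ),
    Nat.card (invariantSets K ρ), Nat.card (invariantSets K σ), ?_, ?_, ?_, ?_, ?_, ?_, ?_⟩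
  · refine card_invariantSets hnq 1 (fun α _ _ => ⟨α, self_mem_projLinSet α, rfl⟩) ?_ ?_
    · rw [← hK]
      exact Nat.card_congr (Equiv.subtypeUnivEquiv fun x => mem_fixedSubfield.2 rfl)
    · rw [← pow_mul, ← hE]
      exact Nat.card_congr (Equiv.subtypeUnivEquiv fun x => rfl)
  · exact card_invariantSets hnq τ (fun α hα h => exists_fixed_mem_projLinSet hnq τ hτK
      (hFK.symm ▸ hτn) hα h) hτfix (card_fixed_eq_pow hn.pos hFE τ hτo)
  · have h := card_invariantSets_modEq (K := K) hr 1 ρ hρr (Commute.one_left ρ)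
    rwa [Set.inter_eq_right.2 (invariantSets_subset
      (τ := ρ) (ρ := 1) (Subgroup.one_mem _))] at h
  · rw [← hinter]
    exact card_invariantSets_modEq hr τ ρ hρr hcomm
  · exact Nat.card_mono (Set.toFinite _) (invariantSets_subset hσρ)
  · have := card_invariantSets_le hnq ρ hρK m (hm ▸ hρr)
    omega
  · rw [← hG, ← sum_card_invariantSets hr hKE]
    have hsum := sum_orderOf_of_card_eq_mul hn hr hnr hG (fun d =>
      if d = 1 then Nat.card (invariantSets K (1 : E ≃ₐ[F] E))
      else if d = n then Nat.card (invariantSets K τ)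
      else if d = r then Nat.card (invariantSets K ρ)
      else Nat.card (invariantSets K σ))
    have hnnr : n * r ≠ n := by nlinarith [hn.pos]
    have hrnr : n * r ≠ r := by nlinarith [hr.pos, hn.two_le]
    have h1nr : n * r ≠ 1 := fun h => hn.ne_one (Nat.eq_one_of_mul_eq_one_right h)
    rw [if_pos rfl, if_neg hn.ne_one, if_pos rfl, if_neg hr.ne_one, if_neg hnr.symm, if_pos rfl,
      if_neg h1nr, if_neg hnnr, if_neg hrnr] at hsum
    rw [← hsum]
    refine Finset.sum_congr rfl fun g _ => ?_
    have hinv : ∀ h : E ≃ₐ[F] E, orderOf g = orderOf h →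
        Nat.card (invariantSets K h) = Nat.card (invariantSets K (g : E ≃ₐ[F] E)) := by
      intro h hgh
      rw [← Subgroup.orderOf_coe] at hgh
      have hz := zpowers_eq_of_orderOf_eq hgh
      rw [Set.Subset.antisymm (invariantSets_subset (hz ▸ Subgroup.mem_zpowers (g : E ≃ₐ[F] E)))
        (invariantSets_subset (hz ▸ Subgroup.mem_zpowers h))]
    split_ifs with h1 h2 h3
    · exact hinv 1 (by rw [h1, orderOf_one])
    · exact hinv τ (by rw [h2, hτo])
    · exact hinv ρ (by rw [h3, hρo])
    · refine hinv σ ?_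
      have hdvd : orderOf g ∣ n * r := hG ▸ orderOf_dvd_card
      obtain ⟨x, y, hx, hy, hxy⟩ := exists_dvd_and_dvd_of_dvd_mul hdvd
      rw [hxy] at h1 h2 h3
      rw [hσo, hxy]
      rcases (Nat.dvd_prime hn).1 hx with hx | hx <;>
        rcases (Nat.dvd_prime hr).1 hy with hy | hy <;> rw [hx, hy] at h1 h2 h3 ⊢
      · exact absurd (one_mul 1) h1
      · exact absurd (one_mul r) h3
      · exact absurd (mul_one n) h2

end OrbitCount

/-! ### Arithmetic of the orbit count -/

section Arithmetic

/-- The count `B (x ^ 3 - x) + x = x ^ r`, as it arises from `card_invariantSets`, over `ℤ`. -/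
theorem mul_sq_sub_one_of_card {x B r : ℕ} (hx : 0 < x) (hr : 0 < r)
    (h : B * ((x + 1) * ((x - 1) * x)) + x = x ^ r) :
    (B : ℤ) * ((x : ℤ) ^ 2 - 1) = (x : ℤ) ^ (r - 1) - 1 := by
  obtain ⟨s, rfl⟩ := Nat.exists_eq_succ_of_ne_zero hr.ne'
  obtain ⟨y, rfl⟩ := Nat.exists_eq_succ_of_ne_zero hx.ne'
  zify at h
  simp only [Nat.succ_eq_add_one, Nat.add_sub_cancel, Nat.cast_add, Nat.cast_one] at h ⊢
  have hy : (y : ℤ) + 1 ≠ 0 := by positivity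
  apply mul_right_cancel₀ hy
  linear_combination h

theorem div_eq_of_card {x B r : ℕ} (hx : 1 < x) (hr : 0 < r)
    (h : B * ((x + 1) * ((x - 1) * x)) + x = x ^ r) :
    ((x : ℚ) ^ (r - 1) - 1) / ((x : ℚ) ^ 2 - 1) = B := by
  have h1 := congrArg (Int.cast : ℤ → ℚ) (mul_sq_sub_one_of_card (by omega) hr h)
  push_cast at h1
  have h2 : (x : ℚ) ^ 2 - 1 ≠ 0 := by
    have : (1 : ℚ) < x := by exact_mod_cast hx
    nlinarith
  rw [← h1, mul_div_cancel_right₀ _ h2]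

/-- The residue modulo `r` of the number of projective linear sets
`(x ^ (r - 1) - 1) / (x ^ 2 - 1)` determines every number of invariant sets that is congruent to it
and at most `(r - 1) / 2`. -/
theorem eq_of_modEq_of_card {x B a r : ℕ} (hr : r.Prime) (hr2 : 2 < r) (hx : 1 < x)
    (h : B * ((x + 1) * ((x - 1) * x)) + x = x ^ r) (hmod : B ≡ a [MOD r]) (ha : 2 * a + 1 ≤ r) :
    (r ∣ x → a = 1) ∧ ((r ∣ x - 1 ∨ r ∣ x + 1) → 2 * a = r - 1) ∧
      (¬ r ∣ x → ¬ r ∣ x - 1 → ¬ r ∣ x + 1 → a = 0) := by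
  have : Fact r.Prime := ⟨hr⟩
  obtain ⟨m, hm⟩ := hr.odd_of_ne_two hr2.ne'
  have hB := mul_sq_sub_one_of_card (by omega) hr.pos h
  have hBa : (B : ZMod r) = a := (ZMod.natCast_eq_natCast_iff _ _ _).2 hmod
  have hr1 : r - 1 = 2 * m := by omega
  rw [hr1] at hB
  -- the geometric sum in `x ^ 2`
  have hgeom : (B : ℤ) * ((x : ℤ) ^ 2 - 1) = (∑ i ∈ Finset.range m, ((x : ℤ) ^ 2) ^ i) *
      ((x : ℤ) ^ 2 - 1) := by rw [hB, geom_sum_mul, pow_mul]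
  have hcast := congrArg (Int.cast : ℤ → ZMod r) hB
  push_cast at hcast
  rw [hBa] at hcast
  have hlt : ∀ a' : ℕ, 2 * a' + 1 ≤ r → (a : ZMod r) = a' → a = a' := by
    intro a' ha' h
    have h1 := (ZMod.natCast_eq_natCast_iff _ _ _).1 h
    exact Nat.ModEq.eq_of_lt_of_lt h1 (by omega) (by omega)
  have hm0 : m ≠ 0 := by omega
  refine ⟨fun hd => hlt 1 (by omega) ?_, fun hd => ?_, fun h0 h1 h2 => hlt 0 (by omega) ?_⟩
  · rw [(ZMod.natCast_eq_zero_iff x r).2 hd, zero_pow (by omega), zero_pow (by omega)] at hcast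
    push_cast
    linear_combination -hcast
  · rw [hr1]
    congr 1
    refine hlt m (by omega) ?_
    have hsq : (x : ZMod r) ^ 2 = 1 := by
      rcases hd with hd | hd
      · have := (ZMod.natCast_eq_zero_iff (x - 1) r).2 hd
        rw [Nat.cast_sub hx.le, Nat.cast_one] at this
        linear_combination (x + 1 : ZMod r) * this
      · have := (ZMod.natCast_eq_zero_iff (x + 1) r).2 hd
        rw [Nat.cast_add, Nat.cast_one] at this
        linear_combination (x - 1 : ZMod r) * this
    have hne : (x : ℤ) ^ 2 - 1 ≠ 0 := by
      have : (1 : ℤ) < x := by omega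
      nlinarith
    have hsum := congrArg (Int.cast : ℤ → ZMod r) (mul_right_cancel₀ hne hgeom)
    push_cast at hsum
    rw [hBa, hsq] at hsum
    simpa using hsum
  · have hx0 : (x : ZMod r) ≠ 0 := fun h => h0 ((ZMod.natCast_eq_zero_iff x r).1 h)
    have hf : (x : ZMod r) ^ (2 * m) = 1 := by
      rw [← hr1]; exact ZMod.pow_card_sub_one_eq_one hx0
    rw [hf, sub_self, mul_eq_zero] at hcast
    rw [Nat.cast_zero]
    refine hcast.resolve_right fun hsq => ?_
    have hmul : ((x : ZMod r) - 1) * (x + 1) = 0 := by linear_combination hsq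
    rcases mul_eq_zero.1 hmul with h | h
    · exact h1 ((ZMod.natCast_eq_zero_iff _ r).1 (by rw [Nat.cast_sub hx.le, Nat.cast_one, h]))
    · exact h2 ((ZMod.natCast_eq_zero_iff _ r).1 (by rw [Nat.cast_add, Nat.cast_one, h]))

end Arithmetic

/-! ### Extended Goppa codes -/

section GoppaCodes

open scoped OnePoint

variable {F K E : Type*} [Field F] [Field K] [Field E] [Algebra K E] [Algebra F E] {N : ℕ}

theorem exists_root_of_irreducible [Finite K] [Finite E] {g : K[X]} (hg : Irreducible g)
    (hE : Module.finrank K E = g.natDegree) : ∃ α : E, Polynomial.aeval α g = 0 := by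
  have : Fact (Irreducible g) := ⟨hg⟩
  have hfin : Module.finrank K (AdjoinRoot g) = g.natDegree := finrank_quotient_span_eq_natDegree
  have : FiniteDimensional K (AdjoinRoot g) :=
    Module.finite_of_finrank_pos (hfin ▸ hg.natDegree_pos)
  have : Finite (AdjoinRoot g) := Module.finite_of_finite K
  obtain ⟨f⟩ := FiniteField.nonempty_algHom_of_finrank_dvd (F := K) (K := AdjoinRoot g) (L := E)
    (by rw [hfin, hE])
  refine ⟨f (AdjoinRoot.root g), ?_⟩
  rw [Polynomial.aeval_algHom_apply, AdjoinRoot.aeval_eq, AdjoinRoot.mk_self, map_zero]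

theorem natDegree_minpoly_of_irreducible {g : K[X]} (hg : Irreducible g) {α : E}
    (hα : Polynomial.aeval α g = 0) : (minpoly K α).natDegree = g.natDegree := by
  rw [← minpoly.eq_of_irreducible hg hα]
  exact Polynomial.natDegree_mul_C (inv_ne_zero (Polynomial.leadingCoeff_ne_zero.2 hg.ne_zero))

/-- The position of each coordinate of the extended code on the projective line: coordinate `i`
sits at `ζ i`, and the parity check at infinity. -/
def coordEquiv {K : Type*} {N : ℕ} (ζ : Fin N ≃ K) : Fin (N + 1) ≃ OnePoint K :=
  finSuccEquivLast.trans (Equiv.optionCongr ζ)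

/-- The function `P ↦ 1 / (α - P)` on the projective line over `K`. -/
noncomputable def pole (α : E) : OnePoint K → E :=
  fun P => P.elim 0 fun x => (α - algebraMap K E x)⁻¹

theorem pole_infty (α : E) : pole (K := K) α ∞ = 0 := rfl

theorem pole_coe (α : E) (x : K) : pole α (x : OnePoint K) = (α - algebraMap K E x)⁻¹ := rfl

theorem coordEquiv_castSucc {K : Type*} {N : ℕ} (ζ : Fin N ≃ K) (i : Fin N) :
    coordEquiv ζ i.castSucc = (ζ i : OnePoint K) :=
  congrArg (Equiv.optionCongr ζ) (finSuccEquivLast_castSucc i)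

theorem coordEquiv_last {K : Type*} {N : ℕ} (ζ : Fin N ≃ K) : coordEquiv ζ (Fin.last N) = ∞ :=
  congrArg (Equiv.optionCongr ζ) finSuccEquivLast_last

/-- Under a fractional linear transformation of both arguments, the function `1 / (α - P)` changes
by an affine function whose coefficients do not depend on `P`. -/
theorem exists_pole_smul [DecidableEq K] {α β : E} (hα : α ∉ Set.range (algebraMap K E))
    (hβ : β ∈ projLinSet K α) : ∃ (g : GL (Fin 2) K) (u v : E), u ≠ 0 ∧
      ∀ P : OnePoint K, pole β (g • P) = u * pole α P + v := by
  obtain ⟨a, b, c, d, hdet, h⟩ := hβ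
  have hden := denom_ne_zero hα hdet
  have hdet' : algebraMap K E a * algebraMap K E d - algebraMap K E b * algebraMap K E c ≠ 0 := by
    rw [← map_mul, ← map_mul, ← map_sub]
    exact (map_ne_zero _).2 hdet
  let g : GL (Fin 2) K := Matrix.GeneralLinearGroup.mkOfDetNeZero !![a, b; c, d]
    (by rwa [Matrix.det_fin_two_of])
  have h00 : g 0 0 = a := rfl
  have h01 : g 0 1 = b := rfl
  have h10 : g 1 0 = c := rfl
  have h11 : g 1 1 = d := rfl
  set μ := algebraMap K E c * α + algebraMap K E d with hμ
  set δ := algebraMap K E a * algebraMap K E d - algebraMap K E b * algebraMap K E c with hδ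
  refine ⟨g, μ ^ 2 / δ, -(algebraMap K E c * μ) / δ, div_ne_zero (pow_ne_zero 2 hden) hdet', ?_⟩
  intro P
  cases P with
  | infty =>
    rw [OnePoint.smul_infty_eq_ite, h00, h10, pole_infty, mul_zero, zero_add]
    split_ifs with hc
    · rw [pole_infty, hc, map_zero, zero_mul, neg_zero, zero_div]
    · have hc' : algebraMap K E c ≠ 0 := (map_ne_zero _).2 hc
      have hsub : β - algebraMap K E (a / c) = -δ / (algebraMap K E c * μ) := by
        rw [h, map_div₀]
        field_simp
        rw [hμ, hδ]
        ring
      rw [pole_coe, hsub, inv_div, div_neg, neg_div]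
  | coe x =>
    have hx : α - algebraMap K E x ≠ 0 := fun h => hα ⟨x, (sub_eq_zero.1 h).symm⟩
    rw [OnePoint.smul_some_eq_ite, h00, h01, h10, h11, pole_coe]
    split_ifs with hc
    · have hc' := congrArg (algebraMap K E) hc
      simp only [map_add, map_mul, map_zero] at hc'
      have hμ' : μ = algebraMap K E c * (α - algebraMap K E x) := by
        rw [hμ]
        linear_combination hc'
      rw [pole_infty]
      field_simp
      rw [hμ']
      ring
    · obtain ⟨y, hy⟩ : ∃ y, y = algebraMap K E (c * x + d) := ⟨_, rfl⟩
      have hy0 : y ≠ 0 := hy ▸ (map_ne_zero (algebraMap K E)).2 hc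
      have hsub : β - algebraMap K E ((a * x + b) / (c * x + d)) =
          δ * (α - algebraMap K E x) / (μ * y) := by
        rw [h, map_div₀, ← hy]
        field_simp
        rw [hμ, hδ, hy]
        simp only [map_add, map_mul]
        ring
      rw [pole_coe, hsub, inv_div]
      field_simp
      rw [hμ, hy]
      simp only [map_add, map_mul]
      ring

/-- Codes defined by the functions `1 / (α - P)` and `1 / (β - P)` are equivalent if a permutation
of the projective line and a field automorphism turn one function into the other up to an affine
change: the parity check absorbs the constant term. -/
theorem codeEquiv_of_pole (ζ : Fin N ≃ K) {C D : Submodule F (Fin (N + 1) → F)} {α β : E}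
    (hC : ∀ c, c ∈ C ↔
      ∑ i, algebraMap F E (c i) * pole α (coordEquiv ζ i) = 0 ∧ ∑ i, c i = 0)
    (hD : ∀ c, c ∈ D ↔
      ∑ i, algebraMap F E (c i) * pole β (coordEquiv ζ i) = 0 ∧ ∑ i, c i = 0)
    (s : E ≃ₐ[F] E) (π : Equiv.Perm (OnePoint K)) {u v : E} (hu : u ≠ 0)
    (h : ∀ P, pole β (π P) = u * s (pole α P) + v) : CodeEquiv C D := by
  let e := coordEquiv ζ
  let ρ : Equiv.Perm (Fin (N + 1)) := e.trans (π.trans e.symm)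
  refine ⟨ρ.symm, fun c => ?_⟩
  rw [hC, hD]
  have hsum : ∑ i, c (ρ.symm i) = ∑ i, c i := Equiv.sum_comp ρ.symm c
  rw [hsum]
  refine and_congr_left fun h0 => ?_
  have h1 : ∑ i, algebraMap F E (c (ρ.symm i)) * pole β (coordEquiv ζ i) =
      u * s (∑ i, algebraMap F E (c i) * pole α (coordEquiv ζ i)) := by
    rw [← Equiv.sum_comp ρ]
    have h2 : ∀ i, coordEquiv ζ (ρ i) = π (coordEquiv ζ i) := fun i => e.apply_symm_apply _
    simp only [Equiv.symm_apply_apply, h2, h, mul_add, Finset.sum_add_distrib]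
    rw [← Finset.sum_mul, ← map_sum, h0, map_zero, zero_mul, add_zero, map_sum, Finset.mul_sum]
    refine Finset.sum_congr rfl fun i _ => ?_
    rw [map_mul, AlgEquiv.commutes]
    ring
  rw [h1, mul_eq_zero, or_iff_right hu, map_eq_zero_iff s s.injective]

variable [Algebra F K]

theorem mem_goppaCode_iff [IsScalarTower F K E] (ζ : Fin N ≃ K) {g : K[X]} (hg : Irreducible g)
    {α : E} (hα : Polynomial.aeval α g = 0) (c : Fin N → F) :
    c ∈ goppaCode ζ g ↔
      ∑ i, algebraMap F E (c i) * (α - algebraMap K E (ζ i))⁻¹ = 0 := by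
  have : Fact (Irreducible g) := ⟨hg⟩
  have hα' : g.eval₂ (algebraMap K E) α = 0 := hα
  let Φ : AdjoinRoot g →+* E := AdjoinRoot.lift (algebraMap K E) α hα'
  have hζ : ∀ x : K, Φ (Ring.inverse (AdjoinRoot.mk g (Polynomial.X - Polynomial.C x))) =
      (α - algebraMap K E x)⁻¹ := by
    intro x
    rw [Ring.inverse_eq_inv', map_inv₀, show Φ (AdjoinRoot.mk g _) = _ from AdjoinRoot.lift_mk hα' _]
    simp
  change (∑ i, AdjoinRoot.of g (algebraMap F K (c i)) *
    Ring.inverse (AdjoinRoot.mk g (Polynomial.X - Polynomial.C (ζ i)))) = 0 ↔ _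
  rw [← map_eq_zero_iff Φ Φ.injective, map_sum]
  have hof : ∀ x : K, Φ (AdjoinRoot.of g x) = algebraMap K E x := fun x => AdjoinRoot.lift_of hα'
  simp only [map_mul, hζ, hof, ← IsScalarTower.algebraMap_apply]

/-- The extended Goppa code of `g` in terms of a root `α` of `g`. -/
theorem mem_extendedCode_iff [IsScalarTower F K E] (ζ : Fin N ≃ K) {g : K[X]}
    (hg : Irreducible g) {α : E} (hα : Polynomial.aeval α g = 0) (c : Fin (N + 1) → F) :
    c ∈ extendedCode (goppaCode ζ g) ↔
      ∑ i, algebraMap F E (c i) * pole α (coordEquiv ζ i) = 0 ∧ ∑ i, c i = 0 := by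
  refine and_congr_left fun _ => ?_
  rw [mem_goppaCode_iff ζ hg hα, Fin.sum_univ_castSucc, coordEquiv_last, pole_infty, mul_zero,
    add_zero]
  simp only [coordEquiv_castSucc, pole_coe]

/-- A field automorphism moves the pole along with the points of the line. -/
theorem exists_pole_apply [Finite K] [IsScalarTower F K E] (s : E ≃ₐ[F] E) (α : E) :
    ∃ π : Equiv.Perm (OnePoint K), ∀ P, pole (s α) (π P) = s (pole α P) := by
  refine ⟨Equiv.optionCongr (s.restrictNormal K).toEquiv, fun P => ?_⟩
  cases P with
  | infty => exact (map_zero s).symm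
  | coe x =>
    change (s α - algebraMap K E (s.restrictNormal K x))⁻¹ = s ((α - algebraMap K E x)⁻¹)
    rw [AlgEquiv.restrictNormal_commutes, map_inv₀, map_sub]

/-- Goppa polynomials whose roots define projective linear sets in the same orbit of the Frobenius
group have equivalent extended codes, so there are at most as many codes as orbits. -/
theorem numExtendedGoppaCodes_le [Fintype F] [Finite K] [Finite E] [IsScalarTower F K E]
    (ζ : Fin N ≃ K) {r : ℕ} (hr : r.Prime) (hfin : Module.finrank K E = r) :
    numExtendedGoppaCodes F ζ r ≤ numOrbits F K E r := by
  classical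
  have key : ∀ C : extendedGoppaCodes F ζ r, ∃ α ∈ degreeSet K E r, ∀ c, c ∈ C.1 ↔
      ∑ i, algebraMap F E (c i) * pole α (coordEquiv ζ i) = 0 ∧ ∑ i, c i = 0 := by
    rintro ⟨_, g, hg, hgr, rfl⟩
    obtain ⟨α, hα⟩ := exists_root_of_irreducible (E := E) hg (hfin.trans hgr.symm)
    exact ⟨α, (natDegree_minpoly_of_irreducible hg hα).trans hgr,
      mem_extendedCode_iff ζ hg hα⟩
  choose α hα hC using key
  let f : Quotient (codeSetoid F ζ r) →
      MulAction.orbitRel.Quotient (frobGroup F E) (projLinSets F K E r) := fun x =>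
    Quotient.mk _ ⟨projLinSet K (α x.out), α x.out, hα x.out, rfl⟩
  refine Nat.card_le_card_of_injective f fun x y hxy => ?_
  obtain ⟨⟨s, hs⟩, hsx⟩ := Quotient.exact hxy
  have hsx' : s '' projLinSet K (α y.out) = projLinSet K (α x.out) := congrArg Subtype.val hsx
  rw [image_projLinSet] at hsx'
  have hyK := (mem_degreeSet_iff hr hfin).1 (apply_mem_degreeSet s (hα y.out))
  obtain ⟨g, u, v, hu, hg⟩ := exists_pole_smul hyK ((projLinSet_eq_iff hyK).1 hsx'.symm)
  obtain ⟨π, hπ⟩ := exists_pole_apply (K := K) s (α y.out)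
  have hequiv : CodeEquiv y.out.1 x.out.1 :=
    codeEquiv_of_pole ζ (hC y.out) (hC x.out) s (π.trans (MulAction.toPerm g)) hu fun P => by
      rw [Equiv.trans_apply, MulAction.toPerm_apply, hg, hπ]
  rw [← x.out_eq, ← y.out_eq]
  exact (Quotient.sound (show (codeSetoid F ζ r) y.out x.out from hequiv)).symm

end GoppaCodes

end GoppaCount

theorem mainTheorem1 {F K E : Type*} [Field F] [Fintype F] [Field K] [Finite K]
    [Field E] [Finite E] [Algebra F K] [Algebra K E] [Algebra F E] [IsScalarTower F K E]
    (p t n r q : ℕ) (hp : p.Prime) (hn : n.Prime) (hr : r.Prime) (hr2 : 2 < r) (hnr : n ≠ r)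
    (hq : q = p ^ t) (hF : Nat.card F = q) (hK : Nat.card K = q ^ n)
    (hE : Nat.card E = q ^ (n * r)) :
    (r = p →
      (GoppaCount.numOrbits F K E r : ℚ) = 1 / ((n : ℚ) * r) *
        (((q : ℚ) ^ (n * (r - 1)) - 1) / ((q : ℚ) ^ (2 * n) - 1) + n * ((r : ℚ) - 1)
          + ((n : ℚ) - 1) * ((q : ℚ) ^ (r - 1) - 1) / ((q : ℚ) ^ 2 - 1))) ∧
    ((r ≠ p ∧ r ∣ q - 1) ∨
      (r ≠ p ∧ r ∣ q ^ n - 1 ∧ ¬ r ∣ q - 1 ∧ r ∣ q + 1) ∨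
      (r ≠ p ∧ ¬ r ∣ q ^ n - 1 ∧ r ∣ q ^ n + 1 ∧ r ∣ q + 1) →
      (GoppaCount.numOrbits F K E r : ℚ) = 1 / ((n : ℚ) * r) *
        (((q : ℚ) ^ (n * (r - 1)) - 1) / ((q : ℚ) ^ (2 * n) - 1) + n * ((r : ℚ) - 1) ^ 2 / 2
          + ((n : ℚ) - 1) * ((q : ℚ) ^ (r - 1) - 1) / ((q : ℚ) ^ 2 - 1))) ∧
    ((r ≠ p ∧ ¬ r ∣ q ^ n - 1 ∧ r ∣ q ^ n + 1 ∧ ¬ r ∣ q + 1) ∨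
      (r ≠ p ∧ r ∣ q ^ n - 1 ∧ ¬ r ∣ q - 1 ∧ ¬ r ∣ q + 1) →
      (GoppaCount.numOrbits F K E r : ℚ) = 1 / ((n : ℚ) * r) *
        (((q : ℚ) ^ (n * (r - 1)) - 1) / ((q : ℚ) ^ (2 * n) - 1) + ((r : ℚ) - 1) ^ 2 / 2
          + ((n : ℚ) - 1) * ((q : ℚ) ^ (r - 1) - 1) / ((q : ℚ) ^ 2 - 1))) ∧
    (r ≠ p ∧ ¬ r ∣ q ^ n - 1 ∧ ¬ r ∣ q ^ n + 1 →
      (GoppaCount.numOrbits F K E r : ℚ) = 1 / ((n : ℚ) * r) *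
        (((q : ℚ) ^ (n * (r - 1)) - 1) / ((q : ℚ) ^ (2 * n) - 1)
          + ((n : ℚ) - 1) * ((q : ℚ) ^ (r - 1) - 1) / ((q : ℚ) ^ 2 - 1))) ∧
    ∀ ζ : Fin (q ^ n) ≃ K,
      GoppaCount.numExtendedGoppaCodes F ζ r ≤ GoppaCount.numOrbits F K E r := by
  have h1q : 1 < q := hF ▸ Finite.one_lt_card
  have h1Q : 1 < q ^ n := Nat.one_lt_pow hn.ne_zero h1q
  have hKE : Module.finrank K E = r := GoppaCount.finrank_eq_of_card (by rw [hE, hK, pow_mul])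
  obtain ⟨N, b, a, c, hN, hb, hNa, hbc, hca, har, hsum⟩ :=
    GoppaCount.exists_orbit_count (E := E) hn hr hr2 hnr hF hK hE
  obtain ⟨ha1, ha2, ha3⟩ := GoppaCount.eq_of_modEq_of_card hr hr2 h1Q hN hNa har
  obtain ⟨hc1, hc2, hc3⟩ := GoppaCount.eq_of_modEq_of_card hr hr2 h1q hb hbc (by omega)
  have hNdiv := GoppaCount.div_eq_of_card h1Q hr.pos hN
  have hbdiv := GoppaCount.div_eq_of_card h1q hr.pos hb
  rw [Nat.cast_pow, ← pow_mul, ← pow_mul, mul_comm n 2] at hNdiv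
  have hn0 : (n : ℚ) ≠ 0 := Nat.cast_ne_zero.2 hn.ne_zero
  have hr0 : (r : ℚ) ≠ 0 := Nat.cast_ne_zero.2 hr.ne_zero
  have hcount : (GoppaCount.numOrbits F K E r : ℚ) = 1 / ((n : ℚ) * r) *
      (N + ((r - 1) * a + (n - 1) * (r - 1) * c) + (n - 1) * b) := by
    have h := congrArg (Nat.cast : ℕ → ℚ) hsum
    push_cast [Nat.cast_sub hn.one_le, Nat.cast_sub hr.one_le] at h
    field_simp
    linear_combination -h
  have hrq : r ≠ p → ¬ r ∣ q := fun hrp h =>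
    hrp ((Nat.prime_dvd_prime_iff_eq hr hp).1 (hr.dvd_of_dvd_pow (hq ▸ h)))
  have hdvd : r ∣ q - 1 → r ∣ q ^ n - 1 := fun h =>
    h.trans (by simpa using Nat.sub_dvd_pow_sub_pow q 1 n)
  have hhalf : ∀ x : ℕ, 2 * x = r - 1 → (x : ℚ) = (r - 1) / 2 := fun x hx => by
    have h := congrArg (Nat.cast : ℕ → ℚ) hx
    push_cast [Nat.cast_sub hr.one_le] at h
    linear_combination h / 2
  rw [hcount, hNdiv, mul_div_assoc ((n : ℚ) - 1), hbdiv]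
  refine ⟨fun hrp => ?_, fun h => ?_, fun h => ?_, fun h => ?_, fun ζ =>
    GoppaCount.numExtendedGoppaCodes_le ζ hr hKE⟩
  · have ht : t ≠ 0 := by
      rintro rfl
      rw [pow_zero] at hq
      omega
    have hd : r ∣ q := by
      rw [hq, hrp]
      exact dvd_pow_self p ht
    rw [ha1 (dvd_pow hd hn.ne_zero), hc1 hd, Nat.cast_one]
    ring
  · have ha' : r ∣ q ^ n - 1 ∨ r ∣ q ^ n + 1 := by
      rcases h with h | h | h
      · exact .inl (hdvd h.2)
      · exact .inl h.2.1
      · exact .inr h.2.2.1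
    have hc' : r ∣ q - 1 ∨ r ∣ q + 1 :=
      h.imp (fun h => h.2) fun h => h.elim (fun h => h.2.2.2) fun h => h.2.2.2
    rw [hhalf a (ha2 ha'), hhalf c (hc2 hc')]
    ring
  · have ha' : r ∣ q ^ n - 1 ∨ r ∣ q ^ n + 1 :=
      h.symm.imp (fun h => h.2.1) fun h => h.2.2.1
    have hc0 : c = 0 := by
      rcases h with h | h
      · exact hc3 (hrq h.1) (fun h' => h.2.1 (hdvd h')) h.2.2.2
      · exact hc3 (hrq h.1) h.2.2.1 h.2.2.2
    rw [hhalf a (ha2 ha'), hc0, Nat.cast_zero]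
    ring
  · have ha0 : a = 0 := ha3 (fun h' => hrq h.1 (hr.dvd_of_dvd_pow h')) h.2.1 h.2.2
    have hc0 : c = 0 := by omega
    rw [ha0, hc0, Nat.cast_zero]
    ring
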